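/- Let $\mathbb{K}\in\{\mathbb{R},\mathbb{C}\}$. Let $(X,Y,\langle\cdot,\cdot\rangle)$ be a norming dual pair over $\mathbb{K}$, i.e. $X,Y$ are Banach spaces and $\langle\cdot,\cdot\rangle:X\times Y\to\mathbb{K}$ is a bilinear form separating points such that $\|x\|=\sup\{|\langle x,y\rangle| : \|y\|\le 1\}$ for all $x\in X$ and $\|y\|=\sup\{|\langle x,y\rangle| : \|x\|\le 1\}$ for all $y\in Y$. Let $\sigma=\sigma(X,Y)$ be the weak topology on $X$ and $L(X,\sigma)$ the set of $\sigma$-continuous linear operators on $X$ (these are automatically norm bounded). A family $\mathbf{T}=(T(t))_{t\ge 0}\subset L(X,\sigma)$ is a semigroup on $(X,Y)$ of type $(M,\omega)$, where $M\ge 1$, $\omega\in\mathbb{R}$, if $T(0)=I$, $T(t+s)=T(t)T(s)$ and $\|T(t)\|\le Me^{\omega t}$ for all $t,s\ge 0$. It is integrable if for all $\lambda\in\mathbb{K}$ with $\operatorname{Re}\lambda>\omega$ there is $R(\lambda)\in L(X,\sigma)$ such that for all $x\in X$, $y\in Y$ the function $t\mapsto e^{-\lambda t}\langle T(t)x,y\rangle$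 is integrable on $(0,\infty)$ and $\langle R(\lambda)x,y\rangle=\int_0^\infty e^{-\lambda t}\langle T(t)x,y\rangle\,dt$. A linear operator $A:D(A)\subset X\to X$ is the generator of such a $\mathbf{T}$ if $R(\lambda)=(\lambda-A)^{-1}$ whenever $\operatorname{Re}\lambda>\omega$. Let $\rho(A)$ be the resolvent set of $A$ with respect to the norm topology, $R(\lambda,A)=(\lambda-A)^{-1}$ for $\lambda\in\rho(A)$, and $\rho_\sigma(A)=\{\lambda\in\rho(A) : R(\lambda,A)\in L(X,\sigma)\}$. For a locally convex topology $\tau$ on $X$, a set $\mathcal{S}$ of linear operators on $X$ is $\tau$-equicontinuous if for every $\tau$-continuous seminorm $p$ there is a $\tau$-continuous seminorm $q$ with $p(Tx)\le q(x)$ for all $x\in X$ and $T\in\mathcal{S}$. $\mathbf{T}$ is $\tau$-continuous if $t\mapsto T(t)x$ is $\tau$-continuous on $[0,\infty)$ for every $x\in X$, and ${}_\alpha$quasi-$\tau$-equicontinuous ($\alpha\in\mathbb{R}$) if $\{e^{-\alpha t}T(t) : t\ge 0\}$ is $\tau$-equicontinuous. A locally convex topology $\tau$ on $X$ is consistent if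 the $\tau$-continuous linear functionals on $X$ are exactly the functionals $\langle\cdot,y\rangle$, $y\in Y$. A subset of $X$ is sequentially $\tau$-dense if every $x\in X$ is the $\tau$-limit of a sequence in it. **Theorem.** Let $\tau$ be a sequentially complete consistent locally convex topology on $X$, let $A$ be a $\sigma$-closed linear operator on $X$, and let $M\ge 1$ and $\omega,\alpha\in\mathbb{R}$. The following are equivalent. 1. $A$ is the generator of a $\tau$-continuous, ${}_\alpha$quasi-$\tau$-equicontinuous, integrable semigroup $\mathbf{T}$ on $(X,Y)$ of type $(M,\omega)$. 2. $D(A)$ is sequentially $\tau$-dense in $X$, and (a) $\{\lambda\in\mathbb{R} : \lambda>\omega\}\subset\rho_\sigma(A)$ and $\|(\lambda-\omega)^kR(\lambda,A)^k\|\le M$ for all real $\lambda>\omega$ and all $k\in\mathbb{N}=\{1,2,\dots\}$; (b) $\{\lambda\in\mathbb{R} : \lambda>\alpha\}\subset\rho(A)$ and the set $\{(\lambda-\alpha)^kR(\lambda,A)^k : \lambda\in\mathbb{R},\ \lambda>\alpha,\ k\in\mathbb{N}\}$ is $\tau$-equicontinuous. -/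

import Mathlib

open Filter Topology MeasureTheory
open scoped NNReal

namespace NormingDualPair

/-- The bounded linear operators on the normed space `X`. (The abbreviation makes sure that the norm
topology is meant, also where another topology on `X` is under consideration.) -/
abbrev BoundedOp (𝕜 X : Type*) [RCLike 𝕜] [NormedAddCommGroup X] [NormedSpace 𝕜 X] : Type _ :=
  X →L[𝕜] X

section Duality

variable {𝕜 X Y : Type*} [RCLike 𝕜] [NormedAddCommGroup X] [NormedSpace 𝕜 X]
  [NormedAddCommGroup Y] [NormedSpace 𝕜 Y]

/-- The bilinear form `B` turns the normed spaces `X`, `Y` (which are assumed to be Banach spaces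
in the theorem) into a norming dual pair: `B` separates points, and the norm of each of the two
spaces is obtained by testing against the closed unit ball of the other one. -/
structure IsNormingDualPair (B : X →ₗ[𝕜] Y →ₗ[𝕜] 𝕜) : Prop where
  nondegenerate : B.Nondegenerate
  norm_left : ∀ x : X, IsLUB {r : ℝ | ∃ y : Y, ‖y‖ ≤ 1 ∧ r = ‖B x y‖} ‖x‖
  norm_right : ∀ y : Y, IsLUB {r : ℝ | ∃ x : X, ‖x‖ ≤ 1 ∧ r = ‖B x y‖} ‖y‖

/-- The weak topology `σ(X, Y)`: the coarsest topology on `X` for which all functionals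
`x ↦ B x y`, `y ∈ Y`, are continuous. -/
@[reducible] def weakTopology (B : X →ₗ[𝕜] Y →ₗ[𝕜] 𝕜) : TopologicalSpace X :=
  TopologicalSpace.induced (fun x y => B x y) Pi.topologicalSpace

/-- `T ∈ L(X, σ)`: the operator `T` is continuous for the weak topology `σ(X, Y)`. -/
def IsWeaklyContinuous (B : X →ₗ[𝕜] Y →ₗ[𝕜] 𝕜) (T : BoundedOp 𝕜 X) : Prop :=
  Continuous[weakTopology B, weakTopology B] (fun x => T x)

/-- `τ` is a consistent topology on `X`: it is a locally convex vector space topology (i.e. it is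
generated by seminorms) whose continuous linear functionals are exactly the functionals
`x ↦ B x y` with `y ∈ Y`. -/
structure IsConsistent (B : X →ₗ[𝕜] Y →ₗ[𝕜] 𝕜) (τ : TopologicalSpace X) : Prop where
  locallyConvex : @PolynormableSpace 𝕜 X _ _ _ τ
  dual_eq : ∀ φ : X →ₗ[𝕜] 𝕜,
    Continuous[τ, inferInstance] (fun x => φ x) ↔ ∃ y : Y, ∀ x : X, φ x = B x y

end Duality

section Topologies

variable {𝕜 X : Type*} [RCLike 𝕜] [NormedAddCommGroup X] [NormedSpace 𝕜 X]

/-- The vector space topology `τ` is sequentially complete: every `τ`-Cauchy sequence is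
`τ`-convergent. -/
def IsSeqComplete (τ : TopologicalSpace X) : Prop :=
  ∀ u : ℕ → X,
    (∀ U ∈ @nhds X τ 0, ∃ N : ℕ, ∀ m ≥ N, ∀ n ≥ N, u m - u n ∈ U) →
      ∃ x : X, Tendsto u atTop (@nhds X τ x)

/-- The set `S` is sequentially `τ`-dense: every point of `X` is the `τ`-limit of a sequence
in `S`. -/
def IsSeqDense (τ : TopologicalSpace X) (S : Set X) : Prop :=
  ∀ x : X, ∃ u : ℕ → X, (∀ n, u n ∈ S) ∧ Tendsto u atTop (@nhds X τ x)

/-- The set `S` of operators is `τ`-equicontinuous: for every `τ`-continuous seminorm `p` there is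
a `τ`-continuous seminorm `q` with `p (T x) ≤ q x` for all `x` and all `T ∈ S`. -/
def IsEquicontinuousSet (τ : TopologicalSpace X) (S : Set (BoundedOp 𝕜 X)) : Prop :=
  ∀ p : Seminorm 𝕜 X, Continuous[τ, inferInstance] (fun x => p x) →
    ∃ q : Seminorm 𝕜 X, Continuous[τ, inferInstance] (fun x => q x) ∧
      ∀ T ∈ S, ∀ x : X, p (T x) ≤ q x

/-- The operator `A`, defined on a subspace of `X`, is `τ`-closed: its graph is closed in `X × X`
for `τ × τ`. -/
def IsClosedOperator (τ : TopologicalSpace X) (A : X →ₗ.[𝕜] X) : Prop :=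
  @IsClosed (X × X) (@instTopologicalSpaceProd X X τ τ) (A.graph : Set (X × X))

end Topologies

section Resolvents

variable {𝕜 X Y : Type*} [RCLike 𝕜] [NormedAddCommGroup X] [NormedSpace 𝕜 X]
  [NormedAddCommGroup Y] [NormedSpace 𝕜 Y]

/-- `R = (z - A)⁻¹`: the bounded operator `R` is a two-sided inverse of `z - A : D(A) → X`. -/
def IsResolventAt (A : X →ₗ.[𝕜] X) (z : 𝕜) (R : BoundedOp 𝕜 X) : Prop :=
  (∀ x : X, ∃ h : R x ∈ A.domain, z • R x - A ⟨R x, h⟩ = x) ∧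
    ∀ x : A.domain, R (z • (x : X) - A x) = x

theorem IsResolventAt.unique {A : X →ₗ.[𝕜] X} {z : 𝕜} {R S : BoundedOp 𝕜 X}
    (hR : IsResolventAt A z R) (hS : IsResolventAt A z S) : R = S := by
  ext x
  obtain ⟨h, hx⟩ := hR.1 x
  have h2 := hS.2 ⟨R x, h⟩
  rw [hx] at h2
  exact h2.symm

/-- The resolvent set `ρ(A)`. -/
def resolventSet (A : X →ₗ.[𝕜] X) : Set 𝕜 :=
  {z | ∃ R : BoundedOp 𝕜 X, IsResolventAt A z R}

open Classical in
/-- The resolvent `R(z, A) = (z - A)⁻¹` for `z ∈ ρ(A)` (and `0` outside `ρ(A)`, where it is never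
used). -/
noncomputable def resolvent (A : X →ₗ.[𝕜] X) (z : 𝕜) : BoundedOp 𝕜 X :=
  if h : ∃ R : BoundedOp 𝕜 X, IsResolventAt A z R then h.choose else 0

theorem IsResolventAt.resolvent_eq {A : X →ₗ.[𝕜] X} {z : 𝕜} {R : BoundedOp 𝕜 X}
    (hR : IsResolventAt A z R) : resolvent A z = R := by
  have h : ∃ R : BoundedOp 𝕜 X, IsResolventAt A z R := ⟨R, hR⟩
  rw [resolvent, dif_pos h]
  exact h.choose_spec.unique hR

/-- The set `ρ_σ(A)` of all `z ∈ ρ(A)` for which `R(z, A)` is `σ`-continuous. -/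
def weakResolventSet (B : X →ₗ[𝕜] Y →ₗ[𝕜] 𝕜) (A : X →ₗ.[𝕜] X) : Set 𝕜 :=
  {z | z ∈ resolventSet A ∧ IsWeaklyContinuous B (resolvent A z)}

end Resolvents

section Semigroups

variable {𝕜 X Y : Type*} [RCLike 𝕜] [NormedAddCommGroup X] [NormedSpace 𝕜 X]
  [NormedAddCommGroup Y] [NormedSpace 𝕜 Y]

/-- `(T(t))_{t ≥ 0}` is a semigroup on `(X, Y)` of type `(M, ω)`. Weakly continuous operators on a
norming dual pair are norm bounded, so it is no restriction to take `T(t)` in `BoundedOp 𝕜 X`. -/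
structure IsSemigroupOfType (B : X →ₗ[𝕜] Y →ₗ[𝕜] 𝕜) (M ω : ℝ) (T : ℝ≥0 → BoundedOp 𝕜 X) :
    Prop where
  weaklyContinuous : ∀ t : ℝ≥0, IsWeaklyContinuous B (T t)
  map_zero : T 0 = ContinuousLinearMap.id 𝕜 X
  map_add : ∀ t s : ℝ≥0, T (t + s) = (T t).comp (T s)
  one_le : 1 ≤ M
  norm_le : ∀ t : ℝ≥0, ‖T t‖ ≤ M * Real.exp (ω * t)

/-- `R` is the Laplace transform of `T` at `z`: for all `x ∈ X`, `y ∈ Y` the function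
`t ↦ e^{-z t} ⟨T(t) x, y⟩` is integrable on `(0, ∞)`, and its integral is `⟨R x, y⟩`. -/
def IsLaplaceTransformAt (B : X →ₗ[𝕜] Y →ₗ[𝕜] 𝕜) (T : ℝ≥0 → BoundedOp 𝕜 X) (z : 𝕜)
    (R : BoundedOp 𝕜 X) : Prop :=
  ∀ (x : X) (y : Y),
    IntegrableOn (fun t : ℝ => NormedSpace.exp (-(z * (t : 𝕜))) * B (T t.toNNReal x) y)
        (Set.Ioi 0) ∧
      B (R x) y = ∫ t in Set.Ioi (0 : ℝ),
        NormedSpace.exp (-(z * (t : 𝕜))) * B (T t.toNNReal x) y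

/-- `T` is an integrable semigroup on `(X, Y)` of type `(M, ω)`: for `Re z > ω` its Laplace
transform at `z` is given by a `σ`-continuous operator. -/
structure IsIntegrableSemigroup (B : X →ₗ[𝕜] Y →ₗ[𝕜] 𝕜) (M ω : ℝ) (T : ℝ≥0 → BoundedOp 𝕜 X) :
    Prop extends IsSemigroupOfType B M ω T where
  laplace : ∀ z : 𝕜, ω < RCLike.re z →
    ∃ R : BoundedOp 𝕜 X, IsWeaklyContinuous B R ∧ IsLaplaceTransformAt B T z R

/-- `A` is the generator of the integrable semigroup `T` of type `(M, ω)`: the Laplace transform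
of `T` at `z` is `(z - A)⁻¹` whenever `Re z > ω`. -/
def IsGenerator (B : X →ₗ[𝕜] Y →ₗ[𝕜] 𝕜) (ω : ℝ) (T : ℝ≥0 → BoundedOp 𝕜 X) (A : X →ₗ.[𝕜] X) :
    Prop :=
  ∀ z : 𝕜, ω < RCLike.re z →
    ∃ R : BoundedOp 𝕜 X, IsLaplaceTransformAt B T z R ∧ IsResolventAt A z R

/-- The semigroup `T` is `τ`-continuous: all its orbits are `τ`-continuous on `[0, ∞)`. -/
def IsContinuousSemigroup (τ : TopologicalSpace X) (T : ℝ≥0 → BoundedOp 𝕜 X) : Prop :=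
  ∀ x : X, Continuous[inferInstance, τ] (fun t : ℝ≥0 => T t x)

/-- The semigroup `T` is `α`-quasi-`τ`-equicontinuous: the set of all `e^{-α t} T(t)`, `t ≥ 0`, is
`τ`-equicontinuous. -/
def IsQuasiEquicontinuous (τ : TopologicalSpace X) (α : ℝ) (T : ℝ≥0 → BoundedOp 𝕜 X) : Prop :=
  IsEquicontinuousSet τ
    {S : BoundedOp 𝕜 X | ∃ t : ℝ≥0, S = ((Real.exp (-(α * t)) : ℝ) : 𝕜) • T t}

end Semigroups

end NormingDualPair

/-!
The proof is the Hille–Yosida theorem, run at the same time for the norm of `X` and for the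
continuous seminorms of `τ`. What the two have in common is that they are suprema of functionals
`x ↦ ‖B x y‖`, `y ∈ Y` (`IsNormedByDual`): for the norm this is the definition of a norming dual
pair, for `τ` it is Hahn–Banach together with consistency (`IsConsistent.isNormedByDual`). Hence
weak identities, such as the one defining the Laplace transform, give estimates for all these
seminorms, and vector valued integrals are not needed.

*From the semigroup to the resolvent.* If `p (T(t) x) ≤ e^{β t} q x`, then
`r x = sup_t e^{-β t} p (T(t) x)` lies between `p` and `q` and satisfies
`r (T(t) x) ≤ e^{β t} r x` (`exists_seminorm_of_semigroup`). Under the Laplace integral this becomes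
`(l - β) r (R(l) x) ≤ r x`, which can be iterated, and so bounds all powers of `R(l)`. Quasi-
equicontinuity gives, by uniform boundedness, a norm estimate `‖T(t)‖ ≤ C e^{α t}`; when `α < ω` it
lets the Neumann series around a large parameter continue the resolvent to `(α, ∞)`, and the
resolvent equation carries the estimate for `r` along (`IsGenerator.exists_isResolventAt`). The
domain is dense because `l R(l) x → x` (`IsGenerator.isSeqDense_domain`).

*From the resolvent to the semigroup.* The exponentials of the Yosida approximations `l² R(l) - l`
inherit both kinds of bounds (`IsNormedByDual.yosidaExp_le`). They converge on `D(A)`, hence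
everywhere by density and equicontinuity, and sequential completeness provides the limit `T(t)`
(`IsHilleYosidaSequence.exists_semigroup`). Weakly `T(t) x - x = ∫₀ᵗ T(s) A x ds` on `D(A)`, so that
integration by parts identifies the Laplace transform at `z` with `(z - A)⁻¹` as soon as the latter
exists (`IsResolventAt.isLaplaceTransformAt`). For complex `z` with `re z > ω` it exists by a
Neumann series around a large real parameter. Weak continuity of all operators comes from
`τ`-continuity, since consistency turns a `τ`-continuous operator into one with an adjoint on `Y`
(`IsConsistent.hasAdjoint`), and operators with an adjoint are closed under absolutely convergent
series.
-/

namespace NormingDualPair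

/-! ### Polynormable spaces -/

section LocallyConvex

variable {𝕜 E : Type*} [RCLike 𝕜] [AddCommGroup E] [Module 𝕜 E] [TopologicalSpace E]
  [PolynormableSpace 𝕜 E]

/-- Hahn–Banach: a continuous seminorm is attained at each point by a continuous functional that it
dominates. -/
theorem exists_strongDual_eq_seminorm {p : Seminorm 𝕜 E} (hp : Continuous p) (z : E) :
    ∃ g : StrongDual 𝕜 E, ‖g z‖ = p z ∧ ∀ x, ‖g x‖ ≤ p x := by
  by_cases hz : p z = 0
  · exact ⟨0, by simp [hz], fun x => by simp⟩
  have hz0 : z ≠ 0 := by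
    rintro rfl
    exact hz (map_zero p)
  let coord := (LinearEquiv.toSpanNonzeroSingleton 𝕜 E z hz0).symm
  obtain ⟨g, hg, hgp⟩ := Module.Dual.exists_continuous_extension_of_le_seminorm
    (Submodule.span 𝕜 {z}) ((p z : 𝕜) • coord.toLinearMap) hp (fun x => by
      obtain ⟨c, rfl⟩ := (LinearEquiv.toSpanNonzeroSingleton 𝕜 E z hz0).surjective x
      have hc : coord (LinearEquiv.toSpanNonzeroSingleton 𝕜 E z hz0 c) = c :=
        LinearEquiv.symm_apply_apply _ c
      rw [LinearMap.smul_apply, LinearEquiv.coe_coe, hc]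
      simp [map_smul_eq_mul, abs_of_nonneg (apply_nonneg p z), mul_comm])
  refine ⟨g, ?_, hgp⟩
  have h1 : coord ⟨z, Submodule.mem_span_singleton_self z⟩ = 1 :=
    LinearEquiv.coord_self 𝕜 E z hz0
  rw [hg ⟨z, Submodule.mem_span_singleton_self z⟩]
  simp [h1]

theorem tendsto_nhds_iff_seminorm {ι : Type*} {l : Filter ι} {u : ι → E} {x : E} :
    Tendsto u l (𝓝 x) ↔
      ∀ p : Seminorm 𝕜 E, Continuous p → Tendsto (fun i => p (u i - x)) l (𝓝 0) := by
  rw [(PolynormableSpace.withSeminorms 𝕜 E).tendsto_nhds]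
  constructor
  · intro h p hp
    rw [Metric.tendsto_nhds]
    intro ε hε
    filter_upwards [h ⟨p, hp⟩ ε hε] with i hi
    rwa [Real.dist_eq, sub_zero, abs_of_nonneg (apply_nonneg p _)]
  · intro h p ε hε
    exact (h p.1 p.2).eventually (gt_mem_nhds hε)

theorem exists_seminorm_ball_subset {U : Set E} (hU : U ∈ 𝓝 (0 : E)) :
    ∃ p : Seminorm 𝕜 E, Continuous p ∧ ∃ ε > 0, ∀ x, p x < ε → x ∈ U := by
  have h := PolynormableSpace.withSeminorms 𝕜 E
  have := h.topologicalAddGroup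
  obtain ⟨s, ε, hε, hs⟩ := (h.mem_nhds_iff 0 U).1 hU
  exact ⟨_, Seminorm.continuous_finsetSup (fun i _ => i.2), ε, hε,
    fun x hx => hs ((Seminorm.mem_ball_zero _).2 hx)⟩

theorem continuous_linearMap_of_norm_le {φ : E →ₗ[𝕜] 𝕜} {q : Seminorm 𝕜 E} (hq : Continuous q)
    {C : ℝ≥0} (h : ∀ x, ‖φ x‖ ≤ C * q x) : Continuous (fun x => φ x) :=
  (PolynormableSpace.withSeminorms 𝕜 E).continuous_normedSpace_rng 𝕜 φ
    ⟨{⟨q, hq⟩}, C, fun x => by simpa [NNReal.smul_def] using h x⟩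

end LocallyConvex

/-! ### Duality pairings and consistent topologies -/

section Duality

variable {𝕜 X Y : Type*} [RCLike 𝕜] [NormedAddCommGroup X] [NormedSpace 𝕜 X]
  [NormedAddCommGroup Y] [NormedSpace 𝕜 Y] {B : X →ₗ[𝕜] Y →ₗ[𝕜] 𝕜}

/-- The seminorm `p` is continuous for `τ` (rather than for the norm topology of `X`). -/
abbrev IsContinuousSeminorm (τ : TopologicalSpace X) (p : Seminorm 𝕜 X) : Prop :=
  Continuous[τ, inferInstance] (fun x => p x)

/-- The seminorm `p` is normed by `Y`: it is the supremum of the functions `x ↦ ‖B x y‖` that it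
dominates. By the bipolar theorem this is lower semicontinuity of `p` for `σ(X, Y)`. Both the norm
of a norming dual pair and the continuous seminorms of a consistent topology have this property,
which lets the two kinds of estimates be proved at once. -/
def IsNormedByDual (B : X →ₗ[𝕜] Y →ₗ[𝕜] 𝕜) (p : Seminorm 𝕜 X) : Prop :=
  ∀ (z : X) (c : ℝ), (∀ y : Y, (∀ x, ‖B x y‖ ≤ p x) → ‖B z y‖ ≤ c) → p z ≤ c

/-- The operator `T` has an adjoint on `Y` with respect to `B`. -/
def HasAdjoint (B : X →ₗ[𝕜] Y →ₗ[𝕜] 𝕜) (T : BoundedOp 𝕜 X) : Prop :=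
  ∀ y : Y, ∃ y' : Y, ∀ x : X, B (T x) y = B x y'

theorem HasAdjoint.isWeaklyContinuous {T : BoundedOp 𝕜 X} (hT : HasAdjoint B T) :
    IsWeaklyContinuous B T := by
  let σ : TopologicalSpace X := weakTopology B
  refine continuous_induced_rng.2 (continuous_pi fun y => ?_)
  obtain ⟨y', hy'⟩ := hT y
  have h : (fun x => B (T x) y) = (fun f : Y → 𝕜 => f y') ∘ fun x => (fun y => B x y) := by
    ext x
    exact hy' x
  change Continuous[σ, _] (fun x => B (T x) y)
  rw [h]
  exact (continuous_apply y').comp continuous_induced_dom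

theorem HasAdjoint.mul {S T : BoundedOp 𝕜 X} (hS : HasAdjoint B S) (hT : HasAdjoint B T) :
    HasAdjoint B (S * T) := by
  intro y
  obtain ⟨y', hy'⟩ := hS y
  obtain ⟨y'', hy''⟩ := hT y'
  exact ⟨y'', fun x => by rw [← hy'', ← hy']; rfl⟩

theorem HasAdjoint.one : HasAdjoint B (1 : BoundedOp 𝕜 X) := fun y => ⟨y, fun _ => rfl⟩

theorem HasAdjoint.pow {T : BoundedOp 𝕜 X} (hT : HasAdjoint B T) (k : ℕ) :
    HasAdjoint B (T ^ k) := by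
  induction k with
  | zero => exact pow_zero T ▸ HasAdjoint.one
  | succ k ih => exact pow_succ T k ▸ ih.mul hT

theorem HasAdjoint.smul {T : BoundedOp 𝕜 X} (hT : HasAdjoint B T) (c : 𝕜) :
    HasAdjoint B (c • T) := by
  intro y
  obtain ⟨y', hy'⟩ := hT y
  exact ⟨c • y', fun x => by simp [hy']⟩

namespace IsNormingDualPair

variable (hB : IsNormingDualPair B)
include hB

theorem norm_apply_le_of_norm_le_one (x : X) {y : Y} (hy : ‖y‖ ≤ 1) : ‖B x y‖ ≤ ‖x‖ :=
  (hB.norm_left x).1 ⟨y, hy, rfl⟩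

theorem norm_apply_le (x : X) (y : Y) : ‖B x y‖ ≤ ‖x‖ * ‖y‖ := by
  by_cases hy : ‖y‖ = 0
  · simp [norm_eq_zero.1 hy]
  have h := hB.norm_apply_le_of_norm_le_one x (y := ((‖y‖⁻¹ : ℝ) : 𝕜) • y) (by
    rw [norm_smul, RCLike.norm_ofReal, abs_of_nonneg (by positivity), inv_mul_cancel₀ hy])
  rw [map_smul, smul_eq_mul, norm_mul, RCLike.norm_ofReal, abs_of_nonneg (by positivity),
    inv_mul_le_iff₀ (lt_of_le_of_ne (norm_nonneg y) (Ne.symm hy))] at h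
  linarith

theorem norm_le_of_forall {x : X} {c : ℝ} (h : ∀ y, ‖y‖ ≤ 1 → ‖B x y‖ ≤ c) : ‖x‖ ≤ c :=
  (hB.norm_left x).2 (by rintro _ ⟨y, hy, rfl⟩; exact h y hy)

theorem norm_right_le_of_forall {y : Y} {c : ℝ} (h : ∀ x, ‖x‖ ≤ 1 → ‖B x y‖ ≤ c) : ‖y‖ ≤ c :=
  (hB.norm_right y).2 (by rintro _ ⟨x, hx, rfl⟩; exact h x hx)

theorem norm_right_le_of_forall_le {y : Y} {c : ℝ} (hc : 0 ≤ c)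
    (h : ∀ x, ‖B x y‖ ≤ c * ‖x‖) : ‖y‖ ≤ c :=
  hB.norm_right_le_of_forall fun x hx => (h x).trans (mul_le_of_le_one_right hc hx)

theorem eq_of_forall {x z : X} (h : ∀ y, B x y = B z y) : x = z := by
  have h0 := hB.nondegenerate.1 (x - z) (fun y => by simp [h])
  exact sub_eq_zero.1 h0

theorem isNormedByDual_norm : IsNormedByDual B (normSeminorm 𝕜 X) := by
  intro z c h
  exact hB.norm_le_of_forall fun y hy =>
    h y fun x => hB.norm_apply_le_of_norm_le_one x hy

end IsNormingDualPair

/-- The functional `x ↦ B x y` as a bounded functional. -/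
noncomputable def IsNormingDualPair.evalRight (hB : IsNormingDualPair B) (y : Y) : X →L[𝕜] 𝕜 :=
  (B.flip y).mkContinuous ‖y‖ fun x => by
    rw [mul_comm]
    exact hB.norm_apply_le x y

@[simp]
theorem IsNormingDualPair.evalRight_apply (hB : IsNormingDualPair B) (x : X) (y : Y) :
    hB.evalRight y x = B x y := rfl

/-- The functional `y ↦ B x y` as a bounded functional. -/
noncomputable def IsNormingDualPair.evalLeft (hB : IsNormingDualPair B) (x : X) : Y →L[𝕜] 𝕜 :=
  (B x).mkContinuous ‖x‖ fun y => hB.norm_apply_le x y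

@[simp]
theorem IsNormingDualPair.evalLeft_apply (hB : IsNormingDualPair B) (x : X) (y : Y) :
    hB.evalLeft x y = B x y := rfl

/-- The operators with an adjoint on `Y` are closed under absolutely convergent series, because
`Y` is complete and its norm is the one of functionals on `X`. -/
theorem IsNormingDualPair.hasAdjoint_of_hasSum [CompleteSpace Y] (hB : IsNormingDualPair B)
    {S : ℕ → BoundedOp 𝕜 X} {T : BoundedOp 𝕜 X} (hS : ∀ k, HasAdjoint B (S k))
    (hsum : Summable fun k => ‖S k‖) (hT : HasSum S T) : HasAdjoint B T := by
  intro y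
  choose y' hy' using fun k => hS k y
  have hle : ∀ k, ‖y' k‖ ≤ ‖S k‖ * ‖y‖ := fun k =>
    hB.norm_right_le_of_forall_le (by positivity) fun x => by
      rw [← hy']
      calc ‖B (S k x) y‖ ≤ ‖S k x‖ * ‖y‖ := hB.norm_apply_le _ _
        _ ≤ (‖S k‖ * ‖x‖) * ‖y‖ := by gcongr; exact (S k).le_opNorm x
        _ = _ := by ring
  have hy : Summable y' := Summable.of_norm_bounded (hsum.mul_right ‖y‖) hle
  refine ⟨∑' k, y' k, fun x => ?_⟩
  have h1 : HasSum (fun k => B (S k x) y) (B (T x) y) := by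
    have := (hT.mapL (ContinuousLinearMap.apply 𝕜 X x)).mapL (hB.evalRight y)
    simpa using this
  have h2 : HasSum (fun k => B x (y' k)) (B x (∑' k, y' k)) := by
    simpa using hy.hasSum.mapL (hB.evalLeft x)
  simp only [hy'] at h1
  exact h1.unique h2

/-- Uniform boundedness: operators on `X` that are pointwise bounded for `σ(X, Y)` are norm
bounded. -/
theorem IsNormingDualPair.exists_norm_le [CompleteSpace X] [CompleteSpace Y]
    (hB : IsNormingDualPair B) {ι : Type*} {S : ι → BoundedOp 𝕜 X}
    (h : ∀ x y, ∃ C, ∀ i, ‖B (S i x) y‖ ≤ C) : ∃ C, ∀ i, ‖S i‖ ≤ C := by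
  refine banach_steinhaus fun x => ?_
  obtain ⟨C, hC⟩ := banach_steinhaus (g := fun i => hB.evalLeft (S i x)) (h x)
  refine ⟨C, fun i => hB.norm_le_of_forall fun y hy => ?_⟩
  calc ‖B (S i x) y‖ = ‖hB.evalLeft (S i x) y‖ := rfl
    _ ≤ ‖hB.evalLeft (S i x)‖ * ‖y‖ := ContinuousLinearMap.le_opNorm _ _
    _ ≤ ‖hB.evalLeft (S i x)‖ := mul_le_of_le_one_right (norm_nonneg _) hy
    _ ≤ C := hC i

/-- A seminorm normed by `Y` does not increase under weak limits. -/
theorem IsNormedByDual.le_of_tendsto {p : Seminorm 𝕜 X} (hp : IsNormedByDual B p) {ι : Type*}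
    {l : Filter ι} [l.NeBot] {u : ι → X} {z : X} {a : ι → ℝ} {c : ℝ}
    (hu : ∀ y, Tendsto (fun i => B (u i) y) l (𝓝 (B z y))) (ha : Tendsto a l (𝓝 c))
    (h : ∀ᶠ i in l, p (u i) ≤ a i) : p z ≤ c := by
  refine hp z c fun y hy => ?_
  exact le_of_tendsto_of_tendsto (hu y).norm ha (h.mono fun i hi => (hy _).trans hi)

namespace IsConsistent

variable {τ : TopologicalSpace X} (hτ : IsConsistent B τ)
include hτ

theorem isNormedByDual {p : Seminorm 𝕜 X} (hp : IsContinuousSeminorm τ p) :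
    IsNormedByDual B p := by
  intro z c h
  obtain ⟨g, hg, hgp⟩ := @exists_strongDual_eq_seminorm 𝕜 X _ _ _ τ hτ.locallyConvex p hp z
  obtain ⟨y, hy⟩ := (hτ.dual_eq (@ContinuousLinearMap.toLinearMap _ _ _ _ _ _ τ _ _ _ _ _ _ g)).1
    (@ContinuousLinearMap.continuous _ _ _ _ _ _ τ _ _ _ _ _ _ g)
  have hy' : ∀ x, g x = B x y := hy
  rw [← hg, hy']
  exact h y fun x => hy' x ▸ hgp x

theorem tendsto_iff {ι : Type*} {l : Filter ι} {u : ι → X} {x : X} :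
    Tendsto u l (@nhds X τ x) ↔
      ∀ p : Seminorm 𝕜 X, IsContinuousSeminorm τ p → Tendsto (fun i => p (u i - x)) l (𝓝 0) :=
  @tendsto_nhds_iff_seminorm 𝕜 X _ _ _ τ hτ.locallyConvex ι l u x

omit hτ in
theorem isContinuousSeminorm_add {p q : Seminorm 𝕜 X} (hp : IsContinuousSeminorm τ p)
    (hq : IsContinuousSeminorm τ q) : IsContinuousSeminorm τ (p + q) :=
  @Continuous.add ℝ _ _ _ X τ _ _ hp hq

theorem continuous_apply (y : Y) : Continuous[τ, inferInstance] (fun x => B x y) :=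
  (hτ.dual_eq (B.flip y)).2 ⟨y, fun _ => rfl⟩

theorem isContinuousSeminorm_apply (y : Y) : IsContinuousSeminorm τ (B.flip y).toSeminorm :=
  @Continuous.norm X 𝕜 _ τ _ (hτ.continuous_apply y)

theorem tendsto_apply {ι : Type*} {l : Filter ι} {u : ι → X} {x : X}
    (h : Tendsto u l (@nhds X τ x)) (y : Y) : Tendsto (fun i => B (u i) y) l (𝓝 (B x y)) :=
  ((@Continuous.tendsto X 𝕜 τ _ _ (hτ.continuous_apply y) x).comp h)

/-- A `τ`-continuous operator has an adjoint on `Y`, as `Y` is the `τ`-dual of `X`. -/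
theorem hasAdjoint {T : BoundedOp 𝕜 X}
    (hT : ∀ p : Seminorm 𝕜 X, IsContinuousSeminorm τ p →
      ∃ q : Seminorm 𝕜 X, IsContinuousSeminorm τ q ∧ ∃ C : ℝ≥0, ∀ x, p (T x) ≤ C * q x) :
    HasAdjoint B T := by
  intro y
  obtain ⟨q, hq, C, hTq⟩ := hT _ (hτ.isContinuousSeminorm_apply y)
  exact (hτ.dual_eq
    { toFun := fun x => B (T x) y
      map_add' := fun _ _ => by simp
      map_smul' := fun _ _ => by simp }).1
    (@continuous_linearMap_of_norm_le 𝕜 X _ _ _ τ hτ.locallyConvex _ q hq C hTq)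

/-- Sequential completeness in terms of seminorms. -/
theorem exists_tendsto (hτc : IsSeqComplete τ) {u : ℕ → X}
    (hu : ∀ p : Seminorm 𝕜 X, IsContinuousSeminorm τ p →
      Tendsto (fun i : ℕ × ℕ => p (u i.1 - u i.2)) atTop (𝓝 0)) :
    ∃ x, Tendsto u atTop (@nhds X τ x) := by
  refine hτc u fun U hU => ?_
  obtain ⟨p, hp, ε, hε, hpU⟩ := @exists_seminorm_ball_subset 𝕜 X _ _ _ τ hτ.locallyConvex U hU
  obtain ⟨⟨N, N'⟩, hN⟩ := eventually_atTop.1 ((hu p hp).eventually (gt_mem_nhds hε))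
  exact ⟨max N N', fun m hm n hn => hpU _
    (hN (m, n) ⟨(le_max_left _ _).trans hm, (le_max_right _ _).trans hn⟩)⟩

/-- Convergence to zero of an equicontinuous family of operators has to be checked on a dense
set only. -/
theorem tendsto_zero_of_dense {D : Set X} (hD : IsSeqDense τ D) {ι : Type*} {l : Filter ι}
    {U : ι → BoundedOp 𝕜 X}
    (hU : ∀ p : Seminorm 𝕜 X, IsContinuousSeminorm τ p →
      ∃ q : Seminorm 𝕜 X, IsContinuousSeminorm τ q ∧ ∃ C : ℝ, ∀ᶠ i in l, ∀ x, p (U i x) ≤ C * q x)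
    (h : ∀ x ∈ D, ∀ p : Seminorm 𝕜 X, IsContinuousSeminorm τ p →
      Tendsto (fun i => p (U i x)) l (𝓝 0))
    (x : X) {p : Seminorm 𝕜 X} (hp : IsContinuousSeminorm τ p) :
    Tendsto (fun i => p (U i x)) l (𝓝 0) := by
  obtain ⟨q, hq, C, hC⟩ := hU p hp
  obtain ⟨u, huD, hu⟩ := hD x
  have hqu : Tendsto (fun n => C * q (u n - x)) atTop (𝓝 0) := by
    simpa using ((hτ.tendsto_iff.1 hu) q hq).const_mul C
  rw [Metric.tendsto_nhds]
  intro ε hε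
  obtain ⟨n, hn⟩ := (hqu.eventually (gt_mem_nhds (half_pos hε))).exists
  filter_upwards [hC, (h (u n) (huD n) p hp).eventually (gt_mem_nhds (half_pos hε))] with i h1 h2
  rw [Real.dist_eq, sub_zero, abs_of_nonneg (apply_nonneg p _)]
  have h3 : U i x = U i (u n) - U i (u n - x) := by simp
  have h4 := map_sub_le_add p (U i (u n)) (U i (u n - x))
  rw [← h3] at h4
  linarith [h1 (u n - x)]

end IsConsistent

end Duality

/-! ### Resolvents and their Neumann series -/

section Resolvents

variable {𝕜 X : Type*} [RCLike 𝕜] [NormedAddCommGroup X] [NormedSpace 𝕜 X]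
  {A : X →ₗ.[𝕜] X} {z w : 𝕜} {R S : BoundedOp 𝕜 X}

/-- The resolvent equation. -/
theorem IsResolventAt.apply_eq_add (hR : IsResolventAt A w R) (hS : IsResolventAt A z S) (x : X) :
    S x = R x + (w - z) • R (S x) := by
  obtain ⟨h, hx⟩ := hS.1 x
  have h1 := hR.2 ⟨S x, h⟩
  have h2 : w • S x - A ⟨S x, h⟩ = x + (w - z) • S x := by
    rw [sub_eq_iff_eq_add] at hx
    rw [sub_smul]
    nth_rewrite 3 [← sub_eq_iff_eq_add.2 hx]
    abel
  have h3 := congrArg R h2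
  rw [map_add, map_smul] at h3
  exact h1.symm.trans h3

theorem IsResolventAt.commute (hR : IsResolventAt A w R) (hS : IsResolventAt A z S) :
    Commute R S := by
  by_cases hzw : w = z
  · subst hzw
    rw [hR.unique hS]
  · ext x
    have h1 := hR.apply_eq_add hS x
    have h2 := hS.apply_eq_add hR x
    have h3 : (w - z) • (R (S x) - S (R x)) = 0 := by
      rw [smul_sub, sub_eq_zero]
      have h4 : (w - z) • R (S x) = S x - R x := by
        rw [eq_sub_iff_add_eq, add_comm]
        exact h1.symm
      have h5 : (w - z) • S (R x) = S x - R x := by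
        rw [← neg_sub z w, neg_smul, neg_eq_iff_eq_neg, neg_sub, eq_sub_iff_add_eq, add_comm]
        exact h2.symm
      rw [h4, h5]
    exact sub_eq_zero.1 ((smul_eq_zero.1 h3).resolve_left (sub_ne_zero.2 hzw))

/-- `z R(z) x - x = R(z) A x` for `x ∈ D(A)`. -/
theorem IsResolventAt.smul_sub_eq (hR : IsResolventAt A w R) (x : A.domain) :
    w • R (x : X) - x = R (A x) := by
  have h := hR.2 x
  rw [map_sub, map_smul] at h
  nth_rewrite 2 [← h]
  abel

/-- Neumann series: if `‖R(w) ^ k‖ ≤ C / c ^ k` for all `k`, then the disc of radius `c` around `w`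
belongs to the resolvent set. -/
theorem IsResolventAt.exists_hasSum [CompleteSpace X] (hR : IsResolventAt A w R) {c C : ℝ}
    (hc : 0 < c) (hb : ∀ k : ℕ, c ^ k * ‖R ^ k‖ ≤ C) (hz : ‖w - z‖ < c) :
    ∃ S, IsResolventAt A z S ∧ (Summable fun k : ℕ => ‖((w - z) • R) ^ k * R‖) ∧
      HasSum (fun k : ℕ => ((w - z) • R) ^ k * R) S := by
  set V : BoundedOp 𝕜 X := (w - z) • R with hV
  have hVn : Summable fun k : ℕ => ‖V ^ k‖ := by
    have h0 : ‖w - z‖ / c < 1 := (div_lt_one hc).2 hz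
    refine Summable.of_nonneg_of_le (fun k => norm_nonneg _) (fun k => ?_)
      ((summable_geometric_of_lt_one (by positivity) h0).mul_left C)
    rw [hV, smul_pow, norm_smul, norm_pow, div_pow, mul_comm, ← mul_div_assoc,
      le_div_iff₀ (by positivity)]
    calc ‖R ^ k‖ * ‖w - z‖ ^ k * c ^ k = (c ^ k * ‖R ^ k‖) * ‖w - z‖ ^ k := by ring
      _ ≤ C * ‖w - z‖ ^ k := by gcongr; exact hb k
  have hVs : Summable fun k : ℕ => V ^ k := hVn.of_norm
  set G := ∑' k : ℕ, V ^ k with hG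
  have h1 : (1 - V) * G = 1 := hVs.one_sub_mul_tsum_pow
  have h2 : G * (1 - V) = 1 := hVs.tsum_pow_mul_one_sub
  have hcomm : G * R = R * G := by
    rw [hG, ← hVs.tsum_mul_right, ← hVs.tsum_mul_left]
    refine tsum_congr fun k => ?_
    exact (((Commute.refl R).smul_left (w - z)).pow_left k).eq
  refine ⟨G * R, ⟨fun x => ?_, fun x => ?_⟩, ?_, hVs.hasSum.mul_right R⟩
  · have hx : (G * R) x = R (G x) := by rw [hcomm]; rfl
    obtain ⟨h, hA⟩ := hR.1 (G x)
    have h' : (G * R) x ∈ A.domain := hx ▸ h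
    refine ⟨h', ?_⟩
    have hA' : A ⟨(G * R) x, h'⟩ = A ⟨R (G x), h⟩ := by congr 2
    rw [hA', hx]
    have h3 : G x - (w - z) • R (G x) = x := by
      have := congrArg (fun Q : BoundedOp 𝕜 X => Q x) h1
      simpa [hV, sub_mul] using this
    have ha := eq_sub_iff_add_eq'.2 (sub_eq_iff_eq_add.1 hA).symm
    rw [ha]
    calc z • R (G x) - (w • R (G x) - G x) = G x - (w - z) • R (G x) := by
          rw [sub_smul]; abel
      _ = x := h3
  · have h3 : R (z • (x : X) - A x) = (1 - V) x := by
      have h4 := hR.2 x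
      have h5 : z • (x : X) - A x = (w • (x : X) - A x) - (w - z) • (x : X) := by
        rw [sub_smul]; abel
      rw [h5, map_sub, h4, map_smul]
      simp [hV]
    change G (R (z • (x : X) - A x)) = x
    rw [h3]
    exact congrArg (fun Q : BoundedOp 𝕜 X => Q x) h2
  · refine Summable.of_nonneg_of_le (fun k => norm_nonneg _) (fun k => ?_) (hVn.mul_right ‖R‖)
    exact norm_mul_le _ _

theorem seminorm_pow_le {p : Seminorm 𝕜 X} {c : ℝ} (hc : 0 ≤ c) (h : ∀ x, c * p (R x) ≤ p x)
    (k : ℕ) (x : X) : c ^ k * p ((R ^ k) x) ≤ p x := by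
  induction k generalizing x with
  | zero => simp
  | succ k ih =>
    calc c ^ (k + 1) * p ((R ^ (k + 1)) x) = c * (c ^ k * p ((R ^ k) (R x))) := by
          rw [pow_succ R k, mul_apply_eq_comp]; ring
      _ ≤ c * p (R x) := by gcongr; exact ih _
      _ ≤ p x := h x

/-- An estimate of Hille–Yosida type at `l₁` propagates to all smaller parameters, by the resolvent
equation. -/
theorem IsResolventAt.seminorm_le_of_le {l₁ l₂ β : ℝ} (hR : IsResolventAt A (l₁ : 𝕜) R)
    (hS : IsResolventAt A (l₂ : 𝕜) S) (hl : l₂ ≤ l₁) (hβ : β < l₂) {p : Seminorm 𝕜 X}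
    (h : ∀ x, (l₁ - β) * p (R x) ≤ p x) (x : X) : (l₂ - β) * p (S x) ≤ p x := by
  have h1 : p (S x) ≤ p (R x) + (l₁ - l₂) * p (R (S x)) := by
    have h2 := map_add_le_add p (R x) (((l₁ : 𝕜) - (l₂ : 𝕜)) • R (S x))
    rw [← hR.apply_eq_add hS x, map_smul_eq_mul, ← RCLike.ofReal_sub, RCLike.norm_ofReal,
      abs_of_nonneg (sub_nonneg.2 hl)] at h2
    exact h2
  have h3 := h x
  have h4 := mul_le_mul_of_nonneg_left (h (S x)) (sub_nonneg.2 hl)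
  have h5 := mul_le_mul_of_nonneg_left h1 (show (0 : ℝ) ≤ l₁ - β by linarith)
  nlinarith

end Resolvents

/-! ### Scalar exponentials -/

section Exponential

variable {𝕜 : Type*} [RCLike 𝕜]

theorem exp_ofReal_eq (r : ℝ) : NormedSpace.exp (r : 𝕜) = (Real.exp r : 𝕜) := by
  have h := NormedSpace.algebraMap_exp_comm (𝔸 := 𝕜) r
  rw [← Real.exp_eq_exp_ℝ] at h
  exact h.symm

theorem norm_exp_eq (z : 𝕜) : ‖NormedSpace.exp z‖ = Real.exp (RCLike.re z) := by
  let : NormedAlgebra ℚ 𝕜 := NormedAlgebra.restrictScalars ℚ ℝ 𝕜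
  have h1 : ((‖NormedSpace.exp z‖ ^ 2 : ℝ) : 𝕜) = ((Real.exp (RCLike.re z) ^ 2 : ℝ) : 𝕜) := by
    have h2 : (starRingEnd 𝕜) (NormedSpace.exp z) = NormedSpace.exp ((starRingEnd 𝕜) z) :=
      NormedSpace.star_exp z
    rw [← Real.exp_nat_mul, ← exp_ofReal_eq, RCLike.ofReal_pow, ← RCLike.mul_conj, h2,
      ← NormedSpace.exp_add, RCLike.add_conj]
    push_cast
    rfl
  have h3 := RCLike.ofReal_injective h1
  exact (sq_eq_sq₀ (norm_nonneg _) (Real.exp_nonneg _)).1 h3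

theorem norm_exp_neg_mul (z : 𝕜) (t : ℝ) :
    ‖NormedSpace.exp (-(z * (t : 𝕜)))‖ = Real.exp (-(RCLike.re z * t)) := by
  rw [norm_exp_eq]
  simp

theorem integrableOn_exp_neg_mul_mul_exp {l β : ℝ} (h : β < l) (c : ℝ) :
    IntegrableOn (fun t : ℝ => Real.exp (-(l * t)) * (Real.exp (β * t) * c)) (Set.Ioi 0) := by
  have h1 := (integrableOn_exp_mul_Ioi (a := β - l) (by linarith) 0).mul_const c
  refine h1.congr (Eventually.of_forall fun t => ?_)
  simp only [← mul_assoc, ← Real.exp_add]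
  ring_nf

theorem integral_exp_neg_mul_mul_exp {l β : ℝ} (h : β < l) (c : ℝ) :
    ∫ t in Set.Ioi (0 : ℝ), Real.exp (-(l * t)) * (Real.exp (β * t) * c) = c / (l - β) := by
  have h1 : ∀ t : ℝ, Real.exp (-(l * t)) * (Real.exp (β * t) * c)
      = Real.exp ((β - l) * t) * c := fun t => by
    rw [← mul_assoc, ← Real.exp_add]
    ring_nf
  simp_rw [h1]
  rw [integral_mul_const, integral_exp_mul_Ioi (by linarith)]
  have h2 : β - l ≠ 0 := by linarith
  have h3 : l - β ≠ 0 := by linarith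
  rw [mul_zero, Real.exp_zero, ← neg_sub l β, neg_div_neg_eq]
  ring

end Exponential

/-! ### Laplace transforms of semigroups -/

section Laplace

variable {𝕜 X Y : Type*} [RCLike 𝕜] [NormedAddCommGroup X] [NormedSpace 𝕜 X]
  [NormedAddCommGroup Y] [NormedSpace 𝕜 Y] {B : X →ₗ[𝕜] Y →ₗ[𝕜] 𝕜} {T : ℝ≥0 → BoundedOp 𝕜 X}
  {R : BoundedOp 𝕜 X} {p : Seminorm 𝕜 X}

/-- Laplace transforms turn growth bounds into resolvent bounds, for every seminorm normed by `Y`. -/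
theorem IsLaplaceTransformAt.seminorm_le {l β : ℝ} (hR : IsLaplaceTransformAt B T (l : 𝕜) R)
    (hβ : β < l) (hp : IsNormedByDual B p) {x : X} {a : ℝ}
    (hT : ∀ t, p (T t x) ≤ Real.exp (β * t) * a) : (l - β) * p (R x) ≤ a := by
  rw [mul_comm, ← le_div_iff₀ (sub_pos.2 hβ)]
  refine hp _ _ fun y hy => ?_
  rw [(hR x y).2, ← integral_exp_neg_mul_mul_exp hβ]
  refine norm_integral_le_of_norm_le (integrableOn_exp_neg_mul_mul_exp hβ _) ?_
  filter_upwards [ae_restrict_mem measurableSet_Ioi] with t ht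
  rw [norm_mul, norm_exp_neg_mul, RCLike.ofReal_re]
  gcongr
  refine (hy _).trans ((hT _).trans_eq ?_)
  rw [Real.coe_toNNReal t (le_of_lt ht)]

/-- If the orbit of `x` stays near `x` for small times and grows at most exponentially, then
`l R(l) x` is near `x` for large `l`. -/
theorem IsLaplaceTransformAt.seminorm_smul_sub_le {l γ : ℝ}
    (hR : IsLaplaceTransformAt B T (l : 𝕜) R) (hγ : γ < l) (hl : 0 < l) (hp : IsNormedByDual B p)
    {x : X} {ε K : ℝ} (hT : ∀ t, p (T t x - x) ≤ ε + K * (Real.exp (γ * t) - 1)) :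
    p ((l : 𝕜) • R x - x) ≤ ε + K * (l / (l - γ) - 1) := by
  refine hp _ _ fun y hy => ?_
  have i0 : ∀ c, IntegrableOn (fun t : ℝ => Real.exp (-(l * t)) * c) (Set.Ioi 0) := fun c => by
    simpa using integrableOn_exp_neg_mul_mul_exp hl c
  have I0 : ∀ c, ∫ t in Set.Ioi (0 : ℝ), Real.exp (-(l * t)) * c = c / l := fun c => by
    simpa using integral_exp_neg_mul_mul_exp hl c
  have i1 : IntegrableOn (fun t : ℝ => NormedSpace.exp (-((l : 𝕜) * (t : 𝕜))) * B x y)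
      (Set.Ioi 0) := by
    have := ((i0 1).ofReal (𝕜 := 𝕜)).mul_const (B x y)
    refine this.congr (Eventually.of_forall fun t => ?_)
    simp only [mul_one]
    rw [← exp_ofReal_eq]
    simp
  have I1 : ∫ t in Set.Ioi (0 : ℝ), NormedSpace.exp (-((l : 𝕜) * (t : 𝕜))) * B x y
      = (l : 𝕜)⁻¹ * B x y := by
    rw [integral_mul_const]
    congr 1
    have h1 : ∀ t : ℝ, NormedSpace.exp (-((l : 𝕜) * (t : 𝕜)))
        = ((Real.exp (-(l * t)) * 1 : ℝ) : 𝕜) := fun t => by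
      rw [mul_one, ← exp_ofReal_eq]
      simp
    simp_rw [h1]
    rw [integral_ofReal, I0]
    simp
  have hl' : (l : 𝕜) ≠ 0 := by exact_mod_cast hl.ne'
  have h1 : B ((l : 𝕜) • R x - x) y = (l : 𝕜) * ∫ t in Set.Ioi (0 : ℝ),
      NormedSpace.exp (-((l : 𝕜) * (t : 𝕜))) * B (T t.toNNReal x - x) y := by
    simp_rw [map_sub, LinearMap.sub_apply, mul_sub]
    rw [integral_sub (hR x y).1 i1, I1, ← (hR x y).2, mul_sub, mul_inv_cancel_left₀ hl',
      map_smul, LinearMap.smul_apply, smul_eq_mul]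
  have i2 : IntegrableOn (fun t : ℝ => Real.exp (-(l * t)) * (Real.exp (γ * t) * K)
      - Real.exp (-(l * t)) * K) (Set.Ioi 0) := (integrableOn_exp_neg_mul_mul_exp hγ K).sub (i0 K)
  have i3 : IntegrableOn (fun t : ℝ => Real.exp (-(l * t)) * ε
      + (Real.exp (-(l * t)) * (Real.exp (γ * t) * K) - Real.exp (-(l * t)) * K)) (Set.Ioi 0) :=
    (i0 ε).add i2
  have h2 : ‖∫ t in Set.Ioi (0 : ℝ),
      NormedSpace.exp (-((l : 𝕜) * (t : 𝕜))) * B (T t.toNNReal x - x) y‖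
      ≤ ε / l + (K / (l - γ) - K / l) := by
    rw [← I0 ε, ← I0 K, ← integral_exp_neg_mul_mul_exp hγ K, ← integral_sub
      (integrableOn_exp_neg_mul_mul_exp hγ K) (i0 K), ← integral_add (i0 ε) i2]
    refine norm_integral_le_of_norm_le i3 ?_
    filter_upwards [ae_restrict_mem measurableSet_Ioi] with t ht
    rw [norm_mul, norm_exp_neg_mul, RCLike.ofReal_re]
    have h3 := (hy (T t.toNNReal x - x)).trans (hT _)
    rw [Real.coe_toNNReal t (le_of_lt ht)] at h3
    calc _ ≤ _ := mul_le_mul_of_nonneg_left h3 (Real.exp_nonneg _)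
      _ = _ := by ring
  rw [h1, norm_mul, RCLike.norm_ofReal, abs_of_pos hl]
  calc _ ≤ _ := mul_le_mul_of_nonneg_left h2 hl.le
    _ = _ := by
      have : l - γ ≠ 0 := by linarith
      field_simp

/-- A seminorm that a semigroup scales by at most `e^{β t}` up to a constant is equivalent to one
that it scales by at most `e^{β t}`, namely `x ↦ sup_t e^{-β t} p (T t x)`. -/
theorem exists_seminorm_of_semigroup (hp : IsNormedByDual B p) (hadj : ∀ t, HasAdjoint B (T t))
    (hzero : T 0 = ContinuousLinearMap.id 𝕜 X) (hadd : ∀ t s, T (t + s) = (T t).comp (T s))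
    {β : ℝ} {q : Seminorm 𝕜 X} (hq : ∀ t x, p (T t x) ≤ Real.exp (β * t) * q x) :
    ∃ r : Seminorm 𝕜 X, IsNormedByDual B r ∧ (∀ x, p x ≤ r x) ∧ (∀ x, r x ≤ q x) ∧
      ∀ t x, r (T t x) ≤ Real.exp (β * t) * r x := by
  have hE : ∀ t : ℝ, Real.exp (-(β * t)) * Real.exp (β * t) = 1 := fun t => by
    rw [← Real.exp_add]; simp
  let P : ℝ≥0 → Seminorm 𝕜 X := fun t =>
    (Real.exp (-(β * t))).toNNReal • p.comp (T t).toLinearMap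
  have hP : ∀ t x, P t x = Real.exp (-(β * t)) * p (T t x) := fun t x => by
    simp [P, NNReal.smul_def, Real.exp_nonneg]
  have hPq : ∀ t x, P t x ≤ q x := fun t x => by
    rw [hP]
    calc _ ≤ Real.exp (-(β * t)) * (Real.exp (β * t) * q x) := by gcongr; exact hq t x
      _ = q x := by rw [← mul_assoc, hE, one_mul]
  have hbdd : BddAbove (Set.range P) := ⟨q, by rintro _ ⟨t, rfl⟩; exact hPq t⟩
  have hr : ∀ x, (⨆ t, P t) x = ⨆ t, P t x := fun x => Seminorm.iSup_apply hbdd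
  have hbx : ∀ x, BddAbove (Set.range fun t => P t x) := fun x =>
    ⟨q x, by rintro _ ⟨t, rfl⟩; exact hPq t x⟩
  have hle : ∀ t x, P t x ≤ (⨆ t, P t) x := fun t x => by
    rw [hr]
    exact le_ciSup (hbx x) t
  refine ⟨⨆ t, P t, ?_, fun x => ?_, fun x => ?_, fun s x => ?_⟩
  · intro z c h
    rw [hr]
    refine ciSup_le fun t => ?_
    rw [hP]
    have h1 : p (T t z) ≤ Real.exp (β * t) * c := by
      refine hp _ _ fun y hy => ?_
      obtain ⟨y', hy'⟩ := hadj t y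
      have h2 := h (((Real.exp (-(β * t)) : ℝ) : 𝕜) • y') fun x => by
        rw [map_smul, ← hy', norm_smul, RCLike.norm_ofReal, abs_of_pos (Real.exp_pos _)]
        refine le_trans ?_ (hle t x)
        rw [hP]
        gcongr
        exact hy _
      rw [map_smul, ← hy', norm_smul, RCLike.norm_ofReal, abs_of_pos (Real.exp_pos _)] at h2
      calc ‖B (T t z) y‖ = Real.exp (β * t) * (Real.exp (-(β * t)) * ‖B (T t z) y‖) := by
            rw [← mul_assoc, mul_comm (Real.exp _), hE, one_mul]
        _ ≤ _ := by gcongr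
    calc _ ≤ Real.exp (-(β * t)) * (Real.exp (β * t) * c) := by gcongr
      _ = c := by rw [← mul_assoc, hE, one_mul]
  · have h1 := hle 0 x
    rw [hP, hzero] at h1
    simpa using h1
  · rw [hr]
    exact ciSup_le fun t => hPq t x
  · rw [hr]
    refine ciSup_le fun t => ?_
    rw [hP]
    have h1 := hle (t + s) x
    rw [hP, hadd] at h1
    calc Real.exp (-(β * t)) * p (T t (T s x))
        = Real.exp (β * s) * (Real.exp (-(β * (t + s : ℝ≥0))) * p (T t (T s x))) := by
          rw [← mul_assoc, ← Real.exp_add]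
          congr 2
          push_cast
          ring
      _ ≤ _ := by gcongr; exact h1

end Laplace

/-! ### From the semigroup to the resolvent estimates -/

section Generation

variable {𝕜 X Y : Type*} [RCLike 𝕜] [NormedAddCommGroup X] [NormedSpace 𝕜 X]
  [NormedAddCommGroup Y] [NormedSpace 𝕜 Y] {B : X →ₗ[𝕜] Y →ₗ[𝕜] 𝕜} {T : ℝ≥0 → BoundedOp 𝕜 X}
  {R : BoundedOp 𝕜 X} {A : X →ₗ.[𝕜] X}

theorem IsNormingDualPair.op_ext (hB : IsNormingDualPair B) {S : BoundedOp 𝕜 X}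
    (h : ∀ x y, B (R x) y = B (S x) y) : R = S :=
  ContinuousLinearMap.ext fun x => hB.eq_of_forall (h x)

theorem opNorm_le_of_forall {C : ℝ} (hC : 0 ≤ C) (h : ∀ x, ‖R x‖ ≤ C * ‖x‖) :
    ‖R‖ ≤ C :=
  ContinuousLinearMap.opNorm_le_bound _ hC h

theorem pow_mul_opNorm_pow_le {c M : ℝ} (hc : 0 ≤ c) (hM : 0 ≤ M)
    (h : ∀ (k : ℕ) (x : X), c ^ k * ‖(R ^ k) x‖ ≤ M * ‖x‖) (k : ℕ) : c ^ k * ‖R ^ k‖ ≤ M := by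
  rw [← abs_of_nonneg (pow_nonneg hc k), ← RCLike.norm_ofReal (K := 𝕜), ← norm_smul]
  refine opNorm_le_of_forall hM fun x => ?_
  rw [smul_apply, norm_smul, RCLike.norm_ofReal, abs_of_nonneg (pow_nonneg hc k)]
  exact h k x

/-- The Hille–Yosida estimate for the powers of the Laplace transform. -/
theorem IsLaplaceTransformAt.pow_mul_norm_pow_le (hB : IsNormingDualPair B)
    (hadj : ∀ t, HasAdjoint B (T t)) (hzero : T 0 = ContinuousLinearMap.id 𝕜 X)
    (hadd : ∀ t s, T (t + s) = (T t).comp (T s)) {β C : ℝ} (hC : 0 ≤ C)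
    (hT : ∀ t, ‖T t‖ ≤ C * Real.exp (β * t)) {l : ℝ} (hl : β < l)
    (hR : IsLaplaceTransformAt B T (l : 𝕜) R) (k : ℕ) : (l - β) ^ k * ‖R ^ k‖ ≤ C := by
  have hq : ∀ x, (C.toNNReal • normSeminorm 𝕜 X) x = C * ‖x‖ := fun x => by
    simp [NNReal.smul_def, hC]
  obtain ⟨r, hr, h1, h2, h3⟩ := exists_seminorm_of_semigroup hB.isNormedByDual_norm hadj hzero hadd
    (q := C.toNNReal • normSeminorm 𝕜 X) (β := β) fun t x => by
      rw [hq]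
      calc ‖T t x‖ ≤ ‖T t‖ * ‖x‖ := (T t).le_opNorm x
        _ ≤ (C * Real.exp (β * t)) * ‖x‖ := by gcongr; exact hT t
        _ = _ := by ring
  simp only [hq] at h2
  have hl0 : 0 ≤ l - β := (sub_pos.2 hl).le
  refine pow_mul_opNorm_pow_le hl0 hC (fun k x => ?_) k
  calc (l - β) ^ k * ‖(R ^ k) x‖ ≤ (l - β) ^ k * r ((R ^ k) x) := by gcongr; exact h1 _
    _ ≤ r x := seminorm_pow_le hl0 (fun x => hR.seminorm_le hl hr fun t => h3 t x) k x
    _ ≤ C * ‖x‖ := h2 x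

/-- If `T` has growth bound `α`, its generator has a resolvent on all of `(α, ∞)`, and there the
resolvent satisfies the same estimates as the Laplace transform. Beyond the half plane of type
`(M, ω)` it is given by a Neumann series around a large parameter. -/
theorem IsGenerator.exists_isResolventAt [CompleteSpace X] (hB : IsNormingDualPair B)
    (hadj : ∀ t, HasAdjoint B (T t)) (hzero : T 0 = ContinuousLinearMap.id 𝕜 X)
    (hadd : ∀ t s, T (t + s) = (T t).comp (T s)) {ω α C : ℝ} (hC : 0 ≤ C)
    (hT : ∀ t, ‖T t‖ ≤ C * Real.exp (α * t)) (hA : IsGenerator B ω T A) {l : ℝ} (hl : α < l) :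
    ∃ S, IsResolventAt A (l : 𝕜) S ∧ ∀ r : Seminorm 𝕜 X, IsNormedByDual B r →
      (∀ t x, r (T t x) ≤ Real.exp (α * t) * r x) → ∀ x, (l - α) * r (S x) ≤ r x := by
  -- a parameter in the half plane where the resolvent is known to be the Laplace transform
  obtain ⟨m, hlm, hωm⟩ : ∃ m, l ≤ m ∧ ω < m :=
    ⟨max l (ω + 1), le_max_left _ _, (lt_add_one ω).trans_le (le_max_right _ _)⟩
  have hαm : α < m := hl.trans_le hlm
  obtain ⟨R, hLR, hR⟩ := hA (m : 𝕜) (by simpa using hωm)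
  obtain ⟨S, hS, -, -⟩ := hR.exists_hasSum (z := (l : 𝕜)) (sub_pos.2 hαm)
    (hLR.pow_mul_norm_pow_le hB hadj hzero hadd hC hT hαm) (by
      rw [← RCLike.ofReal_sub, RCLike.norm_ofReal, abs_of_nonneg (sub_nonneg.2 hlm)]
      linarith)
  refine ⟨S, hS, fun r hr hrT x => ?_⟩
  exact hR.seminorm_le_of_le hS hlm hl
    (fun x => hLR.seminorm_le hαm hr fun t => hrT t x) x

/-- A function of exponential growth that vanishes at `0` is dominated, up to `ε`, by a multiple of
`e^{γ t} - 1`. The Laplace transform of this multiple at `l`, times `l`, tends to zero for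
`l → ∞`. -/
theorem exists_le_add_mul_exp_sub_one {φ : ℝ≥0 → ℝ} {a γ : ℝ} (hγ : 0 < γ)
    (ha : ∀ t : ℝ≥0, φ t ≤ Real.exp (γ * t) * a) (ha0 : 0 ≤ a) (h0 : Tendsto φ (𝓝 0) (𝓝 0))
    {ε : ℝ} (hε : 0 < ε) : ∃ K, ∀ t : ℝ≥0, φ t ≤ ε + K * (Real.exp (γ * t) - 1) := by
  obtain ⟨δ, hδ, hφ⟩ := Metric.eventually_nhds_iff.1 (h0.eventually (gt_mem_nhds hε))
  have h1 : 1 < Real.exp (γ * δ) := Real.one_lt_exp_iff.2 (by positivity)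
  have h1' : 0 < Real.exp (γ * δ) - 1 := by linarith
  refine ⟨a * (Real.exp (γ * δ) / (Real.exp (γ * δ) - 1)), fun t => ?_⟩
  have h2 : 1 ≤ Real.exp (γ * t) := Real.one_le_exp (by positivity)
  rcases lt_or_ge (t : ℝ) δ with ht | ht
  · have h3 := hφ (y := t) (by simpa [NNReal.dist_eq] using ht)
    have h4 : 0 ≤ a * (Real.exp (γ * δ) / (Real.exp (γ * δ) - 1)) * (Real.exp (γ * t) - 1) :=
      mul_nonneg (by positivity) (by linarith)
    linarith
  · have h3 : Real.exp (γ * δ) ≤ Real.exp (γ * t) := Real.exp_le_exp.2 (by gcongr)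
    have h4 : Real.exp (γ * t)
        ≤ Real.exp (γ * δ) / (Real.exp (γ * δ) - 1) * (Real.exp (γ * t) - 1) := by
      rw [div_mul_eq_mul_div, le_div_iff₀ h1']
      linarith
    have h5 := mul_le_mul_of_nonneg_right h4 ha0
    linarith [ha t]

theorem isQuasiEquicontinuous_iff {τ : TopologicalSpace X} {α : ℝ} :
    IsQuasiEquicontinuous τ α T ↔ ∀ p : Seminorm 𝕜 X, IsContinuousSeminorm τ p →
      ∃ q : Seminorm 𝕜 X, IsContinuousSeminorm τ q ∧
        ∀ t x, p (T t x) ≤ Real.exp (α * t) * q x := by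
  have key : ∀ (p : Seminorm 𝕜 X) (t : ℝ≥0) (x : X) (c : ℝ),
      p ((((Real.exp (-(α * t)) : ℝ) : 𝕜) • T t) x) ≤ c ↔ p (T t x) ≤ Real.exp (α * t) * c := by
    intro p t x c
    rw [smul_apply, map_smul_eq_mul, RCLike.norm_ofReal, abs_of_pos (Real.exp_pos _), Real.exp_neg,
      inv_mul_le_iff₀ (Real.exp_pos _)]
  refine forall₂_congr fun p hp => exists_congr fun q => and_congr_right fun hq => ?_
  constructor
  · intro h t x
    exact (key p t x _).1 (h _ ⟨t, rfl⟩ x)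
  · rintro h _ ⟨t, rfl⟩ x
    exact (key p t x _).2 (h t x)

theorem IsQuasiEquicontinuous.hasAdjoint {τ : TopologicalSpace X} (hτ : IsConsistent B τ) {α : ℝ}
    (hα : IsQuasiEquicontinuous τ α T) (t : ℝ≥0) : HasAdjoint B (T t) :=
  hτ.hasAdjoint fun p hp => by
    obtain ⟨q, hq, hpq⟩ := isQuasiEquicontinuous_iff.1 hα p hp
    exact ⟨q, hq, ⟨Real.exp (α * t), Real.exp_nonneg _⟩, hpq t⟩

/-- The domain of the generator of a `τ`-continuous semigroup is sequentially `τ`-dense, as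
`l R(l) x` tends to `x` for `l → ∞`. -/
theorem IsGenerator.isSeqDense_domain {τ : TopologicalSpace X} (hτ : IsConsistent B τ) {ω α : ℝ}
    (hA : IsGenerator B ω T A) (hzero : ∀ x, T 0 x = x)
    (hc : IsContinuousSemigroup τ T) (hα : IsQuasiEquicontinuous τ α T) :
    IsSeqDense τ (A.domain : Set X) := by
  intro x
  set γ : ℝ := |α| + 1 with hγ
  have hγ0 : 0 < γ := by positivity
  let l : ℕ → ℝ := fun n => n + (|ω| + γ + 1)
  have hl0 : ∀ n, 0 < l n := fun n => by positivity
  have hlω : ∀ n, ω < l n := fun n => by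
    have h1 : (0 : ℝ) ≤ n := Nat.cast_nonneg n
    have h2 := le_abs_self ω
    simp only [l]
    linarith
  have hlγ : ∀ n, γ < l n := fun n => by
    have h1 : (0 : ℝ) ≤ n := Nat.cast_nonneg n
    have h2 := abs_nonneg ω
    simp only [l]
    linarith
  have hltop : Tendsto l atTop atTop :=
    tendsto_atTop_add_const_right _ _ tendsto_natCast_atTop_atTop
  choose R hLR hR using fun n => hA (l n : 𝕜) (by simpa using hlω n)
  refine ⟨fun n => (l n : 𝕜) • R n x, fun n => A.domain.smul_mem _ ((hR n).1 x).1,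
    hτ.tendsto_iff.2 fun p hp => ?_⟩
  obtain ⟨q, hq, hpq⟩ := isQuasiEquicontinuous_iff.1 hα p hp
  have hbound : ∀ t : ℝ≥0, p (T t x - x) ≤ Real.exp (γ * t) * (q x + p x) := fun t => by
    have h1 : Real.exp (α * t) ≤ Real.exp (γ * t) :=
      Real.exp_le_exp.2 (by gcongr; linarith [le_abs_self α])
    have h2 : 1 ≤ Real.exp (γ * t) := Real.one_le_exp (by positivity)
    calc p (T t x - x) ≤ p (T t x) + p x := map_sub_le_add p _ _
      _ ≤ Real.exp (α * t) * q x + 1 * p x := by rw [one_mul]; gcongr; exact hpq t x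
      _ ≤ Real.exp (γ * t) * q x + Real.exp (γ * t) * p x := by gcongr
      _ = _ := by ring
  have hlim : Tendsto (fun t : ℝ≥0 => p (T t x - x)) (𝓝 0) (𝓝 0) := by
    have h1 : Tendsto (fun t : ℝ≥0 => T t x) (𝓝 0) (@nhds X τ x) := by
      have h2 := @Continuous.tendsto ℝ≥0 X _ τ _ (hc x) 0
      rwa [hzero] at h2
    exact hτ.tendsto_iff.1 h1 p hp
  rw [Metric.tendsto_nhds]
  intro ε hε
  obtain ⟨K, hK⟩ := exists_le_add_mul_exp_sub_one hγ0 hbound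
    (add_nonneg (apply_nonneg q x) (apply_nonneg p x)) hlim (half_pos hε)
  have hlim2 : Tendsto (fun n => ε / 2 + K * (l n / (l n - γ) - 1)) atTop (𝓝 (ε / 2)) := by
    have h1 : ∀ n, γ / (l n - γ) = l n / (l n - γ) - 1 := fun n => by
      have : l n - γ ≠ 0 := (sub_pos.2 (hlγ n)).ne'
      field_simp
      ring
    have h2 : Tendsto (fun n => γ / (l n - γ)) atTop (𝓝 0) :=
      tendsto_const_nhds.div_atTop (tendsto_atTop_add_const_right _ (-γ) hltop)
    simp only [h1] at h2
    simpa using (h2.const_mul K).const_add (ε / 2)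
  filter_upwards [hlim2.eventually (gt_mem_nhds (half_lt_self hε))] with n hn
  rw [Real.dist_eq, sub_zero, abs_of_nonneg (apply_nonneg p _)]
  exact ((hLR n).seminorm_smul_sub_le (hlγ n) (hl0 n) (hτ.isNormedByDual hp) hK).trans_lt hn

/-- The generator of a `τ`-continuous, quasi-`τ`-equicontinuous semigroup satisfies the estimates
of Hille and Yosida. -/
theorem IsGenerator.hille_yosida_estimates [CompleteSpace X] [CompleteSpace Y]
    (hB : IsNormingDualPair B) {τ : TopologicalSpace X} (hτ : IsConsistent B τ) {M ω α : ℝ}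
    (hT : IsIntegrableSemigroup B M ω T) (hα : IsQuasiEquicontinuous τ α T)
    (hA : IsGenerator B ω T A) :
    ((∀ r : ℝ, ω < r → (r : 𝕜) ∈ weakResolventSet B A) ∧
      ∀ r : ℝ, ω < r → ∀ k : ℕ, 1 ≤ k → ‖((r - ω : ℝ) : 𝕜) ^ k • resolvent A (r : 𝕜) ^ k‖ ≤ M) ∧
    ((∀ r : ℝ, α < r → (r : 𝕜) ∈ resolventSet A) ∧
      IsEquicontinuousSet τ {S : BoundedOp 𝕜 X | ∃ (r : ℝ) (k : ℕ), α < r ∧ 1 ≤ k ∧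
        S = ((r - α : ℝ) : 𝕜) ^ k • resolvent A (r : 𝕜) ^ k}) := by
  have hα' := isQuasiEquicontinuous_iff.1 hα
  have hadj := hα.hasAdjoint hτ
  have hM : 0 ≤ M := zero_le_one.trans hT.one_le
  obtain ⟨C, hC0, hC⟩ : ∃ C, 0 ≤ C ∧ ∀ t, ‖T t‖ ≤ C * Real.exp (α * t) := by
    obtain ⟨C, hC⟩ := hB.exists_norm_le
      (S := fun t : ℝ≥0 => ((Real.exp (-(α * t)) : ℝ) : 𝕜) • T t) fun x y => by
        obtain ⟨q, hq, hpq⟩ := hα _ (hτ.isContinuousSeminorm_apply y)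
        exact ⟨q x, fun t => hpq _ ⟨t, rfl⟩ x⟩
    refine ⟨C, (norm_nonneg _).trans (hC 0), fun t => ?_⟩
    have h1 := hC t
    rwa [norm_smul, RCLike.norm_ofReal, abs_of_pos (Real.exp_pos _), Real.exp_neg,
      inv_mul_le_iff₀ (Real.exp_pos _), mul_comm] at h1
  have hb := fun (l : ℝ) (hl : α < l) =>
    hA.exists_isResolventAt hB hadj hT.map_zero hT.map_add hC0 hC hl
  refine ⟨⟨fun r hr => ?_, fun r hr k _ => ?_⟩, fun r hr => ?_, fun p hp => ?_⟩
  · obtain ⟨R, hLR, hR⟩ := hA (r : 𝕜) (by simpa using hr)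
    obtain ⟨R', hwR', hLR'⟩ := hT.laplace (r : 𝕜) (by simpa using hr)
    have hRR' : R' = R := hB.op_ext fun x y => (hLR' x y).2.trans (hLR x y).2.symm
    exact ⟨⟨R, hR⟩, by rwa [hR.resolvent_eq, ← hRR']⟩
  · obtain ⟨R, hLR, hR⟩ := hA (r : 𝕜) (by simpa using hr)
    rw [hR.resolvent_eq, norm_smul, norm_pow, RCLike.norm_ofReal, abs_of_pos (sub_pos.2 hr)]
    exact hLR.pow_mul_norm_pow_le hB hadj hT.map_zero hT.map_add hM hT.norm_le hr k
  · obtain ⟨S, hS, -⟩ := hb r hr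
    exact ⟨S, hS⟩
  · obtain ⟨q, hq, hpq⟩ := hα' p hp
    obtain ⟨p', hp', h1, h2, h3⟩ := exists_seminorm_of_semigroup (hτ.isNormedByDual hp) hadj
      hT.map_zero hT.map_add hpq
    refine ⟨q, hq, ?_⟩
    rintro _ ⟨r, k, hr, -, rfl⟩ x
    obtain ⟨S, hS, hSp⟩ := hb r hr
    rw [hS.resolvent_eq, smul_apply, map_smul_eq_mul, norm_pow, RCLike.norm_ofReal,
      abs_of_pos (sub_pos.2 hr)]
    calc (r - α) ^ k * p ((S ^ k) x) ≤ (r - α) ^ k * p' ((S ^ k) x) := by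
          have := (sub_pos.2 hr).le
          gcongr
          exact h1 _
      _ ≤ p' x := seminorm_pow_le (sub_pos.2 hr).le (hSp p' hp' h3) k x
      _ ≤ q x := h2 x

end Generation

/-! ### Yosida approximations and their exponentials -/

section Yosida

variable {𝕜 X Y : Type*} [RCLike 𝕜] [NormedAddCommGroup X] [NormedSpace 𝕜 X]
  [NormedAddCommGroup Y] [NormedSpace 𝕜 Y] {B : X →ₗ[𝕜] Y →ₗ[𝕜] 𝕜}
  {R R' : BoundedOp 𝕜 X} {A : X →ₗ.[𝕜] X} {p : Seminorm 𝕜 X} {l l' : ℝ}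

/-- The Yosida approximation `l² R - l = l A R` of `A`, for `R = (l - A)⁻¹`. -/
noncomputable def yosida (l : ℝ) (R : BoundedOp 𝕜 X) : BoundedOp 𝕜 X :=
  ((l ^ 2 : ℝ) : 𝕜) • R - (l : 𝕜) • 1

/-- The norm continuous semigroup generated by the Yosida approximation. -/
noncomputable def yosidaExp (l : ℝ) (R : BoundedOp 𝕜 X) (t : ℝ) : BoundedOp 𝕜 X :=
  NormedSpace.exp ((t : 𝕜) • yosida l R)

theorem yosida_apply_of_mem (hR : IsResolventAt A (l : 𝕜) R) (x : A.domain) :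
    yosida l R x = (l : 𝕜) • R (A x) := by
  rw [← hR.smul_sub_eq x, smul_sub, smul_smul, ← sq]
  simp [yosida]

theorem commute_yosida (h : Commute R R') : Commute (yosida l R) (yosida l' R') :=
  (((h.smul_left _).smul_right _).sub_right ((Commute.one_right _).smul_right _)).sub_left
    ((Commute.one_left _).smul_left _)

theorem yosidaExp_zero : yosidaExp l R 0 = 1 := by
  simp [yosidaExp]

variable [CompleteSpace X]

theorem yosidaExp_add (t s : ℝ) : yosidaExp l R (t + s) = yosidaExp l R t * yosidaExp l R s := by
  let : NormedAlgebra ℚ (BoundedOp 𝕜 X) := NormedAlgebra.restrictScalars ℚ 𝕜 _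
  rw [yosidaExp, RCLike.ofReal_add, add_smul]
  exact NormedSpace.exp_add_of_commute (((Commute.refl _).smul_left _).smul_right _)

/-- Bounds for the powers of `R` bound the exponential of `R`. -/
theorem IsNormedByDual.exp_smul_le (hB : IsNormingDualPair B) (hp : IsNormedByDual B p) {c a : ℝ}
    (hc : 0 < c) {x : X} (h : ∀ k : ℕ, c ^ k * p ((R ^ k) x) ≤ a) {s : ℝ} (hs : 0 ≤ s) :
    p (NormedSpace.exp ((s : 𝕜) • R) x) ≤ Real.exp (s / c) * a := by
  refine hp _ _ fun y hy => ?_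
  have h1 : HasSum (fun k : ℕ => B (((k.factorial : 𝕜)⁻¹ • ((s : 𝕜) • R) ^ k) x) y)
      (B (NormedSpace.exp ((s : 𝕜) • R) x) y) :=
    ((NormedSpace.exp_series_hasSum_exp' (𝕂 := 𝕜) ((s : 𝕜) • R)).mapL
      (ContinuousLinearMap.apply 𝕜 X x)).mapL (hB.evalRight y)
  have h2 : HasSum (fun k : ℕ => (s / c) ^ k / k.factorial * a) (Real.exp (s / c) * a) := by
    rw [Real.exp_eq_exp_ℝ]
    exact (NormedSpace.expSeries_div_hasSum_exp (s / c)).mul_right a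
  refine h1.norm_le_of_bounded h2 fun k => ?_
  have h3 : ‖B ((R ^ k) x) y‖ ≤ a / c ^ k := by
    rw [le_div_iff₀ (pow_pos hc k), mul_comm]
    exact (mul_le_mul_of_nonneg_left (hy _) (pow_pos hc k).le).trans (h k)
  rw [smul_pow]
  simp only [smul_apply, map_smul, LinearMap.smul_apply, smul_eq_mul, norm_mul, norm_inv, norm_pow,
    RCLike.norm_ofReal, abs_of_nonneg hs, RCLike.norm_natCast]
  calc ((k.factorial : ℝ))⁻¹ * (s ^ k * ‖B ((R ^ k) x) y‖)
      ≤ ((k.factorial : ℝ))⁻¹ * (s ^ k * (a / c ^ k)) := by gcongr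
    _ = _ := by rw [div_pow]; ring

theorem yosidaExp_eq (t : ℝ) : yosidaExp l R t =
    ((Real.exp (-(t * l)) : ℝ) : 𝕜) • NormedSpace.exp (((t * l ^ 2 : ℝ) : 𝕜) • R) := by
  let : NormedAlgebra ℚ (BoundedOp 𝕜 X) := NormedAlgebra.restrictScalars ℚ 𝕜 _
  have h1 : (t : 𝕜) • yosida l R
      = algebraMap 𝕜 (BoundedOp 𝕜 X) ((-(t * l) : ℝ) : 𝕜) + ((t * l ^ 2 : ℝ) : 𝕜) • R := by
    rw [yosida, smul_sub, smul_smul, smul_smul, Algebra.algebraMap_eq_smul_one]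
    push_cast
    rw [neg_smul]
    abel
  rw [yosidaExp, h1, NormedSpace.exp_add_of_commute (Algebra.commutes _ _),
    ← NormedSpace.algebraMap_exp_comm, exp_ofReal_eq, Algebra.algebraMap_eq_smul_one, smul_mul_assoc,
    one_mul]

theorem IsNormedByDual.yosidaExp_le (hB : IsNormingDualPair B) (hp : IsNormedByDual B p) {β a : ℝ}
    (hβ : β < l) {x : X} (h : ∀ k : ℕ, (l - β) ^ k * p ((R ^ k) x) ≤ a) {t : ℝ} (ht : 0 ≤ t) :
    p (yosidaExp l R t x) ≤ Real.exp (l * β / (l - β) * t) * a := by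
  have h0 : l - β ≠ 0 := (sub_pos.2 hβ).ne'
  rw [yosidaExp_eq, smul_apply, map_smul_eq_mul, RCLike.norm_ofReal, abs_of_pos (Real.exp_pos _)]
  calc _ ≤ Real.exp (-(t * l)) * (Real.exp (t * l ^ 2 / (l - β)) * a) := by
        gcongr
        exact hp.exp_smul_le hB (sub_pos.2 hβ) h (by positivity)
    _ = _ := by
        rw [← mul_assoc, ← Real.exp_add]
        congr 2
        field_simp
        ring

/-- The derivative of `s ↦ e^{(t - s) A'} e^{s A}` for commuting bounded operators. -/
theorem hasDerivAt_yosidaExp_mul (hB : IsNormingDualPair B) (h : Commute R R') (t s : ℝ) (x : X)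
    (y : Y) : HasDerivAt (fun s : ℝ => B (yosidaExp l' R' (t - s) (yosidaExp l R s x)) y)
      (B (yosidaExp l' R' (t - s) (yosidaExp l R s (yosida l R x - yosida l' R' x))) y) s := by
  let Φ : BoundedOp 𝕜 X →L[𝕜] 𝕜 := (hB.evalRight y).comp (ContinuousLinearMap.apply 𝕜 X x)
  have h1 := hasDerivAt_exp_smul_const (𝕂 := 𝕜) (yosida l R) (s : 𝕜)
  have h2 := (hasDerivAt_exp_smul_const (𝕂 := 𝕜) (yosida l' R') ((t : 𝕜) - (s : 𝕜))).scomp (s : 𝕜)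
    ((hasDerivAt_id (s : 𝕜)).const_sub (t : 𝕜))
  have h3 := (Φ.hasFDerivAt.comp_hasDerivAt (s : 𝕜) (h2.mul h1)).scomp s
    (RCLike.ofRealCLM (K := 𝕜)).hasDerivAt
  have hfun : (fun s : ℝ => B (yosidaExp l' R' (t - s) (yosidaExp l R s x)) y) =
      ((Φ ∘ (((fun u : 𝕜 => NormedSpace.exp (u • yosida l' R')) ∘ fun u => (t : 𝕜) - id u) *
        fun u : 𝕜 => NormedSpace.exp (u • yosida l R))) ∘ RCLike.ofRealCLM (K := 𝕜)) := by
    ext s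
    simp [Φ, yosidaExp]
  rw [hfun]
  refine h3.congr_deriv ?_
  have h4 : Commute (NormedSpace.exp ((s : 𝕜) • yosida l R)) (yosida l' R') :=
    ((commute_yosida h).smul_left _).exp_left
  have h5 : (-1 : 𝕜) • (NormedSpace.exp (((t : 𝕜) - (s : 𝕜)) • yosida l' R') * yosida l' R')
        * NormedSpace.exp ((s : 𝕜) • yosida l R)
      + NormedSpace.exp (((t : 𝕜) - (s : 𝕜)) • yosida l' R')
        * (NormedSpace.exp ((s : 𝕜) • yosida l R) * yosida l R)
      = yosidaExp l' R' (t - s) * (yosidaExp l R s * (yosida l R - yosida l' R')) := by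
    rw [yosidaExp, yosidaExp, RCLike.ofReal_sub, mul_sub, mul_sub, h4.eq, neg_one_smul, neg_mul,
      mul_assoc]
    abel
  have h6 := congrArg Φ h5
  simp only [Function.comp, RCLike.ofRealCLM_apply, RCLike.ofReal_one, one_smul]
  refine h6.trans ?_
  simp [Φ]

theorem hasDerivAt_yosidaExp (hB : IsNormingDualPair B) (s : ℝ) (x : X) (y : Y) :
    HasDerivAt (fun s : ℝ => B (yosidaExp l R s x) y) (B (yosidaExp l R s (yosida l R x)) y) s := by
  -- the second factor is constant for `R' = 0` and `l' = 0`
  have h := hasDerivAt_yosidaExp_mul (l := l) (l' := 0) (R := R) (R' := 0) hB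
    (Commute.zero_right _) 0 s x y
  simpa [yosidaExp, yosida] using h

/-- Two exponentials of commuting bounded operators are as close as the operators are. -/
theorem IsNormedByDual.yosidaExp_sub_le (hB : IsNormingDualPair B) (hp : IsNormedByDual B p)
    (h : Commute R R') {t : ℝ} (ht : 0 ≤ t) {x : X} {K : ℝ}
    (hK : ∀ s, 0 ≤ s → s ≤ t →
      p (yosidaExp l' R' (t - s) (yosidaExp l R s (yosida l R x - yosida l' R' x))) ≤ K) :
    p (yosidaExp l R t x - yosidaExp l' R' t x) ≤ K * t := by
  refine hp _ _ fun y hy => ?_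
  have h1 := norm_image_sub_le_of_norm_deriv_le_segment' (a := 0) (b := t) (C := K)
    (fun s _ => (hasDerivAt_yosidaExp_mul (l := l) (l' := l') hB h t s x y).hasDerivWithinAt)
    (fun s hs => (hy _).trans (hK s hs.1 hs.2.le)) t ⟨ht, le_refl t⟩
  simpa [yosidaExp_zero] using h1

theorem IsNormedByDual.yosidaExp_sub_yosidaExp_le (hB : IsNormingDualPair B)
    (hp : IsNormedByDual B p) {s t : ℝ} (hst : s ≤ t) {x : X} {K : ℝ}
    (hK : ∀ r, s ≤ r → r ≤ t → p (yosidaExp l R r (yosida l R x)) ≤ K) :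
    p (yosidaExp l R t x - yosidaExp l R s x) ≤ K * (t - s) := by
  refine hp _ _ fun y hy => ?_
  have h1 := norm_image_sub_le_of_norm_deriv_le_segment' (a := s) (b := t) (C := K)
    (fun r _ => (hasDerivAt_yosidaExp (l := l) (R := R) hB r x y).hasDerivWithinAt)
    (fun r hr => (hy _).trans (hK r hr.1 hr.2.le)) t ⟨hst, le_refl t⟩
  simpa using h1

end Yosida

/-! ### The Laplace transform inverts `z - A` -/

section LaplaceOfSemigroup

variable {𝕜 X Y : Type*} [RCLike 𝕜] [NormedAddCommGroup X] [NormedSpace 𝕜 X]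
  [NormedAddCommGroup Y] [NormedSpace 𝕜 Y] {B : X →ₗ[𝕜] Y →ₗ[𝕜] 𝕜}
  {T : ℝ≥0 → BoundedOp 𝕜 X} {S : BoundedOp 𝕜 X} {A : X →ₗ.[𝕜] X}

theorem IsNormingDualPair.exists_boundedOp_of_tendsto (hB : IsNormingDualPair B)
    {E : ℕ → BoundedOp 𝕜 X} {L : X → X}
    (hL : ∀ x y, Tendsto (fun n => B (E n x) y) atTop (𝓝 (B (L x) y))) {C : ℝ}
    (hC : ∀ x, ‖L x‖ ≤ C * ‖x‖) : ∃ T : BoundedOp 𝕜 X, (∀ x, T x = L x) := by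
  refine ⟨LinearMap.mkContinuous
    { toFun := L
      map_add' := fun x x' => hB.eq_of_forall fun y => tendsto_nhds_unique (hL (x + x') y) ?_
      map_smul' := fun c x => hB.eq_of_forall fun y => tendsto_nhds_unique (hL (c • x) y) ?_ }
    C hC, fun x => rfl⟩
  · simpa using (hL x y).add (hL x' y)
  · simpa using (hL x y).const_mul c

/-- If the orbits of `T` satisfy `(T(t) x)' = T(t) A x` weakly for `x ∈ D(A)`, the Laplace transform
of `T` inverts `z - A`, since `-e^{-z t} T(t) v` is an antiderivative of `e^{-z t} T(t) (z - A) v`. -/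
theorem IsResolventAt.isLaplaceTransformAt (hB : IsNormingDualPair B) {z : 𝕜} {M ω : ℝ}
    (hS : IsResolventAt A z S) (hz : ω < RCLike.re z)
    (hzero : T 0 = ContinuousLinearMap.id 𝕜 X) (hT : ∀ t, ‖T t‖ ≤ M * Real.exp (ω * t))
    (hcont : ∀ x y, Continuous fun t : ℝ≥0 => B (T t x) y)
    (hderiv : ∀ (x : A.domain) (y : Y) (t : ℝ≥0),
      B (T t x) y - B x y = ∫ s in (0 : ℝ)..t, B (T s.toNNReal (A x)) y) :
    IsLaplaceTransformAt B T z S := by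
  intro x y
  have hc : ∀ x, Continuous fun t : ℝ => B (T t.toNNReal x) y := fun x =>
    (hcont x y).comp continuous_real_toNNReal
  have hexp : ∀ t : ℝ, HasDerivAt (fun t : ℝ => NormedSpace.exp (-(z * (t : 𝕜))))
      (-z * NormedSpace.exp (-(z * (t : 𝕜)))) t := fun t => by
    have h1 := (hasDerivAt_exp_smul_const (𝕂 := 𝕜) (-z) (t : 𝕜)).scomp t
      (RCLike.ofRealCLM (K := 𝕜)).hasDerivAt
    have hfun : (fun t : ℝ => NormedSpace.exp (-(z * (t : 𝕜)))) =
        (fun u : 𝕜 => NormedSpace.exp (u • (-z))) ∘ RCLike.ofRealCLM (K := 𝕜) := by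
      ext t
      simp [mul_comm]
    rw [hfun]
    refine h1.congr_deriv ?_
    simp [mul_comm]
  have hexpc : Continuous fun t : ℝ => NormedSpace.exp (-(z * (t : 𝕜))) :=
    continuous_iff_continuousAt.2 fun t => (hexp t).continuousAt
  have hle : ∀ (x : X) (t : ℝ), 0 ≤ t → ‖NormedSpace.exp (-(z * (t : 𝕜))) * B (T t.toNNReal x) y‖
      ≤ Real.exp (-(RCLike.re z * t)) * (Real.exp (ω * t) * (M * ‖x‖ * ‖y‖)) := fun x t ht => by
    rw [norm_mul, norm_exp_neg_mul]
    gcongr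
    calc ‖B (T t.toNNReal x) y‖ ≤ ‖T t.toNNReal x‖ * ‖y‖ := hB.norm_apply_le _ _
      _ ≤ (‖T t.toNNReal‖ * ‖x‖) * ‖y‖ := by gcongr; exact (T _).le_opNorm x
      _ ≤ (M * Real.exp (ω * t)) * ‖x‖ * ‖y‖ := by
        gcongr
        simpa [Real.coe_toNNReal t ht] using hT t.toNNReal
      _ = _ := by ring
  have hint : ∀ x, IntegrableOn (fun t : ℝ => NormedSpace.exp (-(z * (t : 𝕜))) *
      B (T t.toNNReal x) y) (Set.Ioi 0) := fun x => by
    refine Integrable.mono' (integrableOn_exp_neg_mul_mul_exp hz (M * ‖x‖ * ‖y‖))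
      (hexpc.mul (hc x)).aestronglyMeasurable ?_
    filter_upwards [ae_restrict_mem measurableSet_Ioi] with t ht
    exact hle x t (le_of_lt ht)
  refine ⟨hint x, ?_⟩
  obtain ⟨h, hx⟩ := hS.1 x
  set v : A.domain := ⟨S x, h⟩ with hv
  have hderiv' : ∀ t : ℝ, 0 < t → HasDerivAt (fun t : ℝ => B (T t.toNNReal v) y)
      (B (T t.toNNReal (A v)) y) t := fun t ht => by
    have h1 := ((hc (A v)).integral_hasStrictDerivAt 0 t).hasDerivAt.const_add (B v y)
    refine h1.congr_of_eventuallyEq ?_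
    filter_upwards [lt_mem_nhds ht] with s hs
    have h2 := hderiv v y s.toNNReal
    rw [Real.coe_toNNReal s hs.le] at h2
    rw [← h2]
    abel
  have hF : ∀ t ∈ Set.Ioi (0 : ℝ), HasDerivAt
      (fun t : ℝ => -(NormedSpace.exp (-(z * (t : 𝕜))) * B (T t.toNNReal v) y))
      (NormedSpace.exp (-(z * (t : 𝕜))) * B (T t.toNNReal x) y) t := fun t ht => by
    refine ((hexp t).mul (hderiv' t ht)).neg.congr_deriv ?_
    rw [← hx]
    simp only [map_sub, map_smul, LinearMap.sub_apply, LinearMap.smul_apply, smul_eq_mul]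
    ring
  have hlim : Tendsto (fun t : ℝ => -(NormedSpace.exp (-(z * (t : 𝕜))) * B (T t.toNNReal v) y))
      atTop (𝓝 0) := by
    rw [tendsto_zero_iff_norm_tendsto_zero]
    have h1 : Tendsto (fun t : ℝ => Real.exp (-(RCLike.re z * t)) *
        (Real.exp (ω * t) * (M * ‖(v : X)‖ * ‖y‖))) atTop (𝓝 0) := by
      have h2 : Tendsto (fun t : ℝ => Real.exp (-((RCLike.re z - ω) * t))) atTop (𝓝 0) :=
        Real.tendsto_exp_neg_atTop_nhds_zero.comp
          (tendsto_id.const_mul_atTop (sub_pos.2 hz))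
      have h3 := h2.mul_const (M * ‖(v : X)‖ * ‖y‖)
      rw [zero_mul] at h3
      refine h3.congr fun t => ?_
      rw [← mul_assoc (Real.exp (-(RCLike.re z * t))), ← Real.exp_add]
      ring_nf
    refine tendsto_of_tendsto_of_tendsto_of_le_of_le' tendsto_const_nhds h1
      (Eventually.of_forall fun t => norm_nonneg _) ?_
    filter_upwards [eventually_ge_atTop 0] with t ht
    rw [norm_neg]
    exact hle v t ht
  have hfin := integral_Ioi_of_hasDerivAt_of_tendsto
    (hexpc.mul (hc v)).neg.continuousWithinAt hF (hint x) hlim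
  rw [hfin]
  simp [hzero, hv]

end LaplaceOfSemigroup

/-! ### Growth rates of the approximations -/

section Rate

theorem mul_div_sub_le {l β : ℝ} (h : 2 * |β| + 1 ≤ l) : l * β / (l - β) ≤ 2 * |β| := by
  have h1 := le_abs_self β
  have h2 := abs_nonneg β
  rw [div_le_iff₀ (by linarith)]
  nlinarith [mul_nonneg h2 (show (0 : ℝ) ≤ l - 2 * β by linarith)]

theorem tendsto_mul_div_sub {l : ℕ → ℝ} (hl : Tendsto l atTop atTop) (β : ℝ) :
    Tendsto (fun n => l n * β / (l n - β)) atTop (𝓝 β) := by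
  have h1 : Tendsto (fun n => β + β ^ 2 / (l n - β)) atTop (𝓝 (β + 0)) :=
    (tendsto_const_nhds.div_atTop (tendsto_atTop_add_const_right _ (-β) hl)).const_add β
  rw [add_zero] at h1
  refine h1.congr' ?_
  filter_upwards [hl.eventually_gt_atTop β] with n hn
  have : l n - β ≠ 0 := (sub_pos.2 hn).ne'
  field_simp
  ring

/-- The half plane `re z > ω` is the union of the discs around real `l` with radius `l - ω`. -/
theorem norm_sub_lt_of_le {𝕜 : Type*} [RCLike 𝕜] {z : 𝕜} {ω l : ℝ} (hz : ω < RCLike.re z)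
    (hl : |ω| + |RCLike.re z| + RCLike.im z ^ 2 / (RCLike.re z - ω) + 1 ≤ l) :
    ‖(l : 𝕜) - z‖ < l - ω := by
  have h0 : 0 < RCLike.re z - ω := sub_pos.2 hz
  have h1 := le_abs_self ω
  have h2 := le_abs_self (RCLike.re z)
  have h3 : 0 ≤ RCLike.im z ^ 2 / (RCLike.re z - ω) := by positivity
  have h5 := abs_nonneg (RCLike.re z)
  have h4 : RCLike.im z ^ 2 < (RCLike.re z - ω) * (2 * l - ω - RCLike.re z) := by
    rw [← div_lt_iff₀' h0]
    linarith [abs_nonneg ω]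
  refine lt_of_pow_lt_pow_left₀ 2 (by linarith) ?_
  rw [RCLike.norm_sq_eq_def]
  simp only [map_sub, RCLike.ofReal_re, RCLike.ofReal_im]
  nlinarith

end Rate

/-! ### The limit semigroup -/

section HilleYosida

variable {𝕜 X Y : Type*} [RCLike 𝕜] [NormedAddCommGroup X] [NormedSpace 𝕜 X]
  [NormedAddCommGroup Y] [NormedSpace 𝕜 Y] {B : X →ₗ[𝕜] Y →ₗ[𝕜] 𝕜}
  {l : ℕ → ℝ} {R : ℕ → BoundedOp 𝕜 X} {A : X →ₗ.[𝕜] X} {M ω α : ℝ}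

theorem limit_yosidaExp_zero {τ : TopologicalSpace X} {T : ℝ≥0 → BoundedOp 𝕜 X}
    (hT : ∀ (t : ℝ≥0) (x : X),
      Tendsto (fun n => yosidaExp (l n) (R n) t x) atTop (@nhds X τ (T t x)))
    (hB : IsNormingDualPair B) (hτ : IsConsistent B τ)
    (x : X) : T 0 x = x := by
  refine hB.eq_of_forall fun y => tendsto_nhds_unique (hτ.tendsto_apply (hT 0 x) y) ?_
  simp only [NNReal.coe_zero, yosidaExp_zero]
  exact tendsto_const_nhds

/-- Resolvents `R n = R(l n, A)` with `l n → ∞` that satisfy the estimates of Hille and Yosida with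
growth bound `ω` for the norm and with growth bound `α` for the topology `τ`. The parameters `l n`
stay away from `ω` and `α`, so that the Yosida approximations grow uniformly in `n`. -/
structure IsHilleYosidaSequence (τ : TopologicalSpace X) (A : X →ₗ.[𝕜] X) (M ω α : ℝ) (l : ℕ → ℝ)
    (R : ℕ → BoundedOp 𝕜 X) : Prop where
  tendsto : Tendsto l atTop atTop
  le : ∀ n, 2 * |α| + 2 * |ω| + 1 ≤ l n
  isResolventAt : ∀ n, IsResolventAt A (l n : 𝕜) (R n)
  norm_le : ∀ n k x, (l n - ω) ^ k * ‖(R n ^ k) x‖ ≤ M * ‖x‖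
  seminorm_le : ∀ p : Seminorm 𝕜 X, IsContinuousSeminorm τ p →
    ∃ q : Seminorm 𝕜 X, IsContinuousSeminorm τ q ∧
      ∀ n k x, (l n - α) ^ k * p ((R n ^ k) x) ≤ q x

namespace IsHilleYosidaSequence

variable {τ : TopologicalSpace X} (hR : IsHilleYosidaSequence τ A M ω α l R)
include hR

theorem two_mul_abs_right_le (n : ℕ) : 2 * |α| + 1 ≤ l n := by
  linarith [hR.le n, abs_nonneg ω]

theorem two_mul_abs_left_le (n : ℕ) : 2 * |ω| + 1 ≤ l n := by
  linarith [hR.le n, abs_nonneg α]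

theorem right_lt (n : ℕ) : α < l n := by
  linarith [hR.two_mul_abs_right_le n, le_abs_self α, abs_nonneg α]

theorem left_lt (n : ℕ) : ω < l n := by
  linarith [hR.two_mul_abs_left_le n, le_abs_self ω, abs_nonneg ω]

theorem zero_lt (n : ℕ) : 0 < l n := by
  linarith [hR.two_mul_abs_right_le n, abs_nonneg α]

theorem hasAdjoint (hτ : IsConsistent B τ) (n : ℕ) : HasAdjoint B (R n) := by
  refine hτ.hasAdjoint fun p hp => ?_
  obtain ⟨q, hq, hpq⟩ := hR.seminorm_le p hp
  have h0 := sub_pos.2 (hR.right_lt n)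
  refine ⟨q, hq, ⟨(l n - α)⁻¹, by positivity⟩, fun x => ?_⟩
  have h1 := hpq n 1 x
  rw [pow_one, pow_one] at h1
  exact (le_inv_mul_iff₀ h0).2 h1

/-- `l n R(l n, A) x` tends to `x` for all `x`, because it does so on the domain. -/
theorem tendsto_smul_sub (hτ : IsConsistent B τ) (hD : IsSeqDense τ (A.domain : Set X)) (x : X)
    {p : Seminorm 𝕜 X} (hp : IsContinuousSeminorm τ p) :
    Tendsto (fun n => p ((l n : 𝕜) • R n x - x)) atTop (𝓝 0) := by
  refine hτ.tendsto_zero_of_dense (U := fun n => (l n : 𝕜) • R n - 1) hD (fun p hp => ?_)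
    (fun x hx p hp => ?_) x hp
  · obtain ⟨q, hq, hpq⟩ := hR.seminorm_le p hp
    refine ⟨q, hq, 3, Eventually.of_forall fun n x => ?_⟩
    have h1 := hpq n 1 x
    have h2 := hpq n 0 x
    rw [pow_one, pow_one] at h1
    rw [pow_zero, pow_zero, one_mul] at h2
    have h0 := hR.right_lt n
    have h3 : l n * p (R n x) ≤ 2 * q x := by
      have h4 : l n ≤ 2 * (l n - α) := by
        linarith [hR.two_mul_abs_right_le n, le_abs_self α]
      calc l n * p (R n x) ≤ 2 * (l n - α) * p (R n x) := by gcongr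
        _ = 2 * ((l n - α) * p (R n x)) := by ring
        _ ≤ _ := by gcongr
    calc p ((l n : 𝕜) • R n x - x) ≤ p ((l n : 𝕜) • R n x) + p x := map_sub_le_add p _ _
      _ = l n * p (R n x) + p x := by
        rw [map_smul_eq_mul, RCLike.norm_ofReal, abs_of_pos (hR.zero_lt n)]
      _ ≤ 2 * q x + q x := add_le_add h3 h2
      _ = 3 * q x := by ring
  · obtain ⟨q, hq, hpq⟩ := hR.seminorm_le p hp
    have h1 : Tendsto (fun n => q (A ⟨x, hx⟩) / (l n - α)) atTop (𝓝 0) :=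
      tendsto_const_nhds.div_atTop (tendsto_atTop_add_const_right _ (-α) hR.tendsto)
    refine squeeze_zero (fun n => apply_nonneg p _) (fun n => ?_) h1
    have h2 := hpq n 1 (A ⟨x, hx⟩)
    rw [pow_one, pow_one] at h2
    rw [le_div_iff₀ (sub_pos.2 (hR.right_lt n)), mul_comm]
    change (l n - α) * p ((l n : 𝕜) • R n x - x) ≤ _
    rw [(hR.isResolventAt n).smul_sub_eq ⟨x, hx⟩]
    exact h2

/-- The Yosida approximations converge to `A` on its domain. -/
theorem tendsto_yosida (hτ : IsConsistent B τ) (hD : IsSeqDense τ (A.domain : Set X))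
    (x : A.domain) {p : Seminorm 𝕜 X} (hp : IsContinuousSeminorm τ p) :
    Tendsto (fun n => p (yosida (l n) (R n) x - A x)) atTop (𝓝 0) := by
  simp only [yosida_apply_of_mem (hR.isResolventAt _)]
  exact hR.tendsto_smul_sub hτ hD (A x) hp

theorem tendsto_seminorm_yosida (hτ : IsConsistent B τ) (hD : IsSeqDense τ (A.domain : Set X))
    (x : A.domain) {p : Seminorm 𝕜 X} (hp : IsContinuousSeminorm τ p) :
    Tendsto (fun n => p (yosida (l n) (R n) x)) atTop (𝓝 (p (A x))) := by
  rw [tendsto_iff_norm_sub_tendsto_zero]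
  refine squeeze_zero (fun n => norm_nonneg _) (fun n => ?_) (hR.tendsto_yosida hτ hD x hp)
  exact abs_sub_map_le_sub p _ _

variable [CompleteSpace X]

theorem seminorm_yosidaExp_le (hB : IsNormingDualPair B) (hτ : IsConsistent B τ) {p : Seminorm 𝕜 X}
    (hp : IsContinuousSeminorm τ p) : ∃ q : Seminorm 𝕜 X, IsContinuousSeminorm τ q ∧
      (∀ n t x, 0 ≤ t →
        p (yosidaExp (l n) (R n) t x) ≤ Real.exp (l n * α / (l n - α) * t) * q x) ∧
      ∀ n t x, 0 ≤ t → p (yosidaExp (l n) (R n) t x) ≤ Real.exp (2 * |α| * t) * q x := by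
  obtain ⟨q, hq, hpq⟩ := hR.seminorm_le p hp
  have h1 : ∀ n t x, 0 ≤ t →
      p (yosidaExp (l n) (R n) t x) ≤ Real.exp (l n * α / (l n - α) * t) * q x :=
    fun n t x ht => (hτ.isNormedByDual hp).yosidaExp_le hB (hR.right_lt n)
      (fun k => hpq n k x) ht
  refine ⟨q, hq, h1, fun n t x ht => (h1 n t x ht).trans ?_⟩
  have h2 := mul_div_sub_le (hR.two_mul_abs_right_le n)
  gcongr

/-- The exponentials of the Yosida approximations converge. On the domain of `A` this follows from
the convergence of the approximations, and equicontinuity extends it to all of `X`. -/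
theorem exists_tendsto_yosidaExp (hB : IsNormingDualPair B) (hτ : IsConsistent B τ)
    (hτc : IsSeqComplete τ) (hD : IsSeqDense τ (A.domain : Set X)) {t : ℝ} (ht : 0 ≤ t) (x : X) :
    ∃ z, Tendsto (fun n => yosidaExp (l n) (R n) t x) atTop (@nhds X τ z) := by
  refine hτ.exists_tendsto hτc fun p hp => ?_
  refine hτ.tendsto_zero_of_dense (ι := ℕ × ℕ)
    (U := fun i => yosidaExp (l i.1) (R i.1) t - yosidaExp (l i.2) (R i.2) t) hD
    (fun p hp => ?_) (fun x hx p hp => ?_) x hp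
  · obtain ⟨q, hq, -, hpq⟩ := hR.seminorm_yosidaExp_le hB hτ hp
    refine ⟨q, hq, 2 * Real.exp (2 * |α| * t), Eventually.of_forall fun i x => ?_⟩
    calc _ ≤ p (yosidaExp (l i.1) (R i.1) t x) + p (yosidaExp (l i.2) (R i.2) t x) :=
          map_sub_le_add p _ _
      _ ≤ _ := add_le_add (hpq i.1 t x ht) (hpq i.2 t x ht)
      _ = _ := by ring
  · obtain ⟨q₁, hq₁, -, hpq₁⟩ := hR.seminorm_yosidaExp_le hB hτ hp
    obtain ⟨q, hq, -, hpq⟩ := hR.seminorm_yosidaExp_le hB hτ hq₁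
    have h1 := hR.tendsto_yosida hτ hD ⟨x, hx⟩ hq
    have h2 : Tendsto (fun i : ℕ × ℕ => Real.exp (2 * |α| * t) *
        (q (yosida (l i.1) (R i.1) x - A ⟨x, hx⟩) + q (yosida (l i.2) (R i.2) x - A ⟨x, hx⟩)) * t)
        atTop (𝓝 0) := by
      rw [← prod_atTop_atTop_eq]
      simpa using (((h1.comp tendsto_fst).add (h1.comp tendsto_snd)).const_mul
        (Real.exp (2 * |α| * t))).mul_const t
    refine squeeze_zero (fun i => apply_nonneg p _) (fun i => ?_) h2
    refine (hτ.isNormedByDual hp).yosidaExp_sub_le hB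
      ((hR.isResolventAt i.1).commute (hR.isResolventAt i.2)) ht fun s hs hst => ?_
    calc _ ≤ Real.exp (2 * |α| * (t - s)) * q₁ (yosidaExp (l i.1) (R i.1) s
            (yosida (l i.1) (R i.1) x - yosida (l i.2) (R i.2) x)) :=
          hpq₁ i.2 _ _ (sub_nonneg.2 hst)
      _ ≤ Real.exp (2 * |α| * (t - s)) * (Real.exp (2 * |α| * s) *
            q (yosida (l i.1) (R i.1) x - yosida (l i.2) (R i.2) x)) := by
          gcongr
          exact hpq i.1 _ _ hs
      _ = Real.exp (2 * |α| * t) * q (yosida (l i.1) (R i.1) x - yosida (l i.2) (R i.2) x) := by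
          rw [← mul_assoc, ← Real.exp_add]
          ring_nf
      _ ≤ _ := by
          gcongr
          rw [← sub_sub_sub_cancel_right _ _ (A ⟨x, hx⟩)]
          exact map_sub_le_add q _ _

/-- The semigroup of a Hille–Yosida sequence, as the limit of the exponentials of the Yosida
approximations. -/
theorem exists_semigroup (hB : IsNormingDualPair B) (hτ : IsConsistent B τ)
    (hτc : IsSeqComplete τ) (hD : IsSeqDense τ (A.domain : Set X)) :
    ∃ T : ℝ≥0 → BoundedOp 𝕜 X,
      (∀ (t : ℝ≥0) (x : X), Tendsto (fun n => yosidaExp (l n) (R n) t x) atTop (@nhds X τ (T t x))) ∧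
      ∀ (t : ℝ≥0) (x : X), ‖T t x‖ ≤ M * Real.exp (ω * t) * ‖x‖ := by
  have h : ∀ t : ℝ≥0, ∃ T : BoundedOp 𝕜 X,
      (∀ x, Tendsto (fun n => yosidaExp (l n) (R n) t x) atTop (@nhds X τ (T x))) ∧
      ∀ x, ‖T x‖ ≤ M * Real.exp (ω * t) * ‖x‖ := by
    intro t
    choose L hL using fun x => hR.exists_tendsto_yosidaExp hB hτ hτc hD t.coe_nonneg x
    have hLn : ∀ x, ‖L x‖ ≤ M * Real.exp (ω * t) * ‖x‖ := fun x => by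
      refine hB.isNormedByDual_norm.le_of_tendsto (hτ.tendsto_apply (hL x))
        (a := fun n => Real.exp (l n * ω / (l n - ω) * t) * (M * ‖x‖)) ?_
        (Eventually.of_forall fun n => ?_)
      · have h1 := ((Real.continuous_exp.tendsto _).comp
          ((tendsto_mul_div_sub hR.tendsto ω).mul_const (t : ℝ))).mul_const (M * ‖x‖)
        rw [show M * Real.exp (ω * t) * ‖x‖ = Real.exp (ω * t) * (M * ‖x‖) by ring]
        exact h1
      · exact hB.isNormedByDual_norm.yosidaExp_le hB (hR.left_lt n)
          (fun k => hR.norm_le n k x) t.coe_nonneg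
    obtain ⟨T, hT⟩ := hB.exists_boundedOp_of_tendsto
      (fun x => hτ.tendsto_apply (hL x)) hLn
    exact ⟨T, fun x => by rw [hT]; exact hL x, fun x => by rw [hT]; exact hLn x⟩
  choose T hT using h
  exact ⟨T, fun t => (hT t).1, fun t => (hT t).2⟩

variable {T : ℝ≥0 → BoundedOp 𝕜 X}
  (hT : ∀ (t : ℝ≥0) (x : X),
    Tendsto (fun n => yosidaExp (l n) (R n) t x) atTop (@nhds X τ (T t x)))
include hT

theorem isQuasiEquicontinuous_limit (hB : IsNormingDualPair B) (hτ : IsConsistent B τ) :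
    IsQuasiEquicontinuous τ α T := by
  refine isQuasiEquicontinuous_iff.2 fun p hp => ?_
  obtain ⟨q, hq, hpq, -⟩ := hR.seminorm_yosidaExp_le hB hτ hp
  refine ⟨q, hq, fun t x => ?_⟩
  refine (hτ.isNormedByDual hp).le_of_tendsto (hτ.tendsto_apply (hT t x))
    (((Real.continuous_exp.tendsto _).comp
      ((tendsto_mul_div_sub hR.tendsto α).mul_const (t : ℝ))).mul_const (q x))
    (Eventually.of_forall fun n => hpq n t x t.coe_nonneg)

theorem limit_add (hB : IsNormingDualPair B) (hτ : IsConsistent B τ) (t s : ℝ≥0) (x : X) :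
    T (t + s) x = T t (T s x) := by
  have h1 : Tendsto (fun n => yosidaExp (l n) (R n) (t + s : ℝ≥0) x) atTop
      (@nhds X τ (T t (T s x))) := by
    refine hτ.tendsto_iff.2 fun p hp => ?_
    obtain ⟨q, hq, -, hpq⟩ := hR.seminorm_yosidaExp_le hB hτ hp
    have h2 := (hτ.tendsto_iff.1 (hT s x) q hq).const_mul (Real.exp (2 * |α| * t))
    have h3 := h2.add (hτ.tendsto_iff.1 (hT t (T s x)) p hp)
    rw [mul_zero, add_zero] at h3
    refine squeeze_zero (fun n => apply_nonneg p _) (fun n => ?_) h3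
    have h4 : yosidaExp (l n) (R n) (t + s : ℝ≥0) x - T t (T s x) =
        yosidaExp (l n) (R n) t (yosidaExp (l n) (R n) s x - T s x) +
          (yosidaExp (l n) (R n) t (T s x) - T t (T s x)) := by
      rw [NNReal.coe_add, yosidaExp_add, map_sub, mul_apply_eq_comp]
      abel
    rw [h4]
    exact (map_add_le_add p _ _).trans (add_le_add_left (hpq n t _ t.coe_nonneg) _)
  exact hB.eq_of_forall fun y =>
    tendsto_nhds_unique (hτ.tendsto_apply (hT (t + s) x) y) (hτ.tendsto_apply h1 y)

/-- Orbits in the domain are Lipschitz continuous on bounded intervals. -/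
theorem seminorm_limit_sub_le (hB : IsNormingDualPair B) (hτ : IsConsistent B τ)
    (hD : IsSeqDense τ (A.domain : Set X)) {p : Seminorm 𝕜 X} (hp : IsContinuousSeminorm τ p)
    (b : ℝ≥0) (x : A.domain) : ∃ K, ∀ s t : ℝ≥0, s ≤ b → t ≤ b →
      p (T s x - T t x) ≤ K * dist s t := by
  obtain ⟨q, hq, -, hpq⟩ := hR.seminorm_yosidaExp_le hB hτ hp
  have key : ∀ s t : ℝ≥0, s ≤ t → t ≤ b →
      p (T t x - T s x) ≤ Real.exp (2 * |α| * b) * q (A x) * (t - s) := by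
    intro s t hst htb
    refine (hτ.isNormedByDual hp).le_of_tendsto
      (u := fun n => yosidaExp (l n) (R n) t x - yosidaExp (l n) (R n) s x) (fun y => ?_)
      (((hR.tendsto_seminorm_yosida hτ hD x hq).const_mul (Real.exp (2 * |α| * b))).mul_const
        ((t : ℝ) - s)) (Eventually.of_forall fun n => ?_)
    · simp only [map_sub, LinearMap.sub_apply]
      exact (hτ.tendsto_apply (hT t x) y).sub (hτ.tendsto_apply (hT s x) y)
    · refine (hτ.isNormedByDual hp).yosidaExp_sub_yosidaExp_le hB hst fun r hsr hrt => ?_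
      have hr : 0 ≤ r := s.coe_nonneg.trans hsr
      have hrb : r ≤ b := hrt.trans htb
      refine (hpq n r _ hr).trans ?_
      gcongr
  refine ⟨Real.exp (2 * |α| * b) * q (A x), fun s t hs ht => ?_⟩
  rw [NNReal.dist_eq]
  rcases le_total s t with h | h
  · rw [map_sub_rev, abs_sub_comm, abs_of_nonneg (sub_nonneg.2 (NNReal.coe_le_coe.2 h))]
    exact key s t h ht
  · rw [abs_of_nonneg (sub_nonneg.2 (NNReal.coe_le_coe.2 h))]
    exact key t s h hs

theorem isContinuousSemigroup_limit (hB : IsNormingDualPair B) (hτ : IsConsistent B τ)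
    (hD : IsSeqDense τ (A.domain : Set X)) : IsContinuousSemigroup τ T := by
  intro x
  rw [@continuous_iff_continuousAt ℝ≥0 X _ τ]
  intro t
  refine hτ.tendsto_iff.2 fun p hp => ?_
  have hnear : ∀ᶠ s in 𝓝 t, s ≤ t + 1 := eventually_le_nhds (lt_add_one t)
  refine hτ.tendsto_zero_of_dense (U := fun s => T s - T t) hD (fun p hp => ?_)
    (fun x hx p hp => ?_) x hp
  · obtain ⟨q, hq, hpq⟩ := isQuasiEquicontinuous_iff.1
      (hR.isQuasiEquicontinuous_limit hT hB hτ) p hp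
    have hb : ∀ s ≤ t + 1, ∀ x, p (T s x) ≤ Real.exp (|α| * (t + 1 : ℝ≥0)) * q x :=
      fun s hs x => by
        have h1 : α * s ≤ |α| * (t + 1 : ℝ≥0) :=
          mul_le_mul (le_abs_self α) (NNReal.coe_le_coe.2 hs) s.coe_nonneg (abs_nonneg α)
        refine (hpq s x).trans ?_
        gcongr
    refine ⟨q, hq, 2 * Real.exp (|α| * (t + 1 : ℝ≥0)), ?_⟩
    filter_upwards [hnear] with s hs x
    calc _ ≤ p (T s x) + p (T t x) := map_sub_le_add p _ _
      _ ≤ _ := add_le_add (hb s hs x) (hb t le_self_add x)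
      _ = _ := by ring
  · obtain ⟨K, hK⟩ := hR.seminorm_limit_sub_le hT hB hτ hD hp (t + 1) ⟨x, hx⟩
    have h1 : Tendsto (fun s => K * dist s t) (𝓝 t) (𝓝 0) := by
      have h2 : Tendsto (fun s => dist s t) (𝓝 t) (𝓝 (dist t t)) :=
        tendsto_id.dist tendsto_const_nhds
      rw [dist_self] at h2
      simpa using h2.const_mul K
    refine tendsto_of_tendsto_of_tendsto_of_le_of_le' tendsto_const_nhds h1
      (Eventually.of_forall fun s => apply_nonneg p _) ?_
    filter_upwards [hnear] with s hs
    exact hK s t hs le_self_add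

/-- Weakly, `T(t) x - x = ∫₀ᵗ T(s) A x ds` for `x ∈ D(A)`: pass to the limit in the corresponding
identity for the Yosida approximations. -/
theorem limit_sub_eq_integral (hB : IsNormingDualPair B) (hτ : IsConsistent B τ)
    (hD : IsSeqDense τ (A.domain : Set X)) (x : A.domain) (y : Y) (t : ℝ≥0) :
    B (T t x) y - B x y = ∫ s in (0 : ℝ)..t, B (T s.toNNReal (A x)) y := by
  obtain ⟨q, hq, -, hpq⟩ := hR.seminorm_yosidaExp_le hB hτ (hτ.isContinuousSeminorm_apply y)
  have hcont : ∀ n w, Continuous fun s : ℝ => B (yosidaExp (l n) (R n) s w) y := fun n w =>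
    continuous_iff_continuousAt.2 fun s => (hasDerivAt_yosidaExp hB s w y).continuousAt
  have h1 : ∀ n, B (yosidaExp (l n) (R n) t x) y - B x y =
      ∫ s in (0 : ℝ)..t, B (yosidaExp (l n) (R n) s (yosida (l n) (R n) x)) y := fun n => by
    rw [intervalIntegral.integral_eq_sub_of_hasDerivAt
      (fun s _ => hasDerivAt_yosidaExp hB s (x : X) y) ((hcont n _).intervalIntegrable _ _),
      yosidaExp_zero]
    rfl
  have h2 : Tendsto (fun n => B (yosidaExp (l n) (R n) t x) y - B x y) atTop
      (𝓝 (B (T t x) y - B x y)) := (hτ.tendsto_apply (hT t x) y).sub_const _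
  refine tendsto_nhds_unique h2 ?_
  simp only [h1]
  have hq1 := hR.tendsto_seminorm_yosida hτ hD x hq
  refine intervalIntegral.tendsto_integral_filter_of_dominated_convergence
    (fun _ => Real.exp (2 * |α| * t) * (q (A x) + 1))
    (Eventually.of_forall fun n => (hcont n _).aestronglyMeasurable) ?_
    intervalIntegrable_const ?_
  · filter_upwards [hq1.eventually (gt_mem_nhds (lt_add_one (q (A x))))] with n hn
    refine Eventually.of_forall fun s hs => ?_
    rw [Set.uIoc_of_le t.coe_nonneg] at hs
    calc _ ≤ Real.exp (2 * |α| * s) * q (yosida (l n) (R n) x) := hpq n s _ hs.1.le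
      _ ≤ _ := by
        have := hs.2
        gcongr
  · refine Eventually.of_forall fun s hs => ?_
    rw [Set.uIoc_of_le t.coe_nonneg] at hs
    have h3 := hT s.toNNReal (A x)
    rw [Real.coe_toNNReal s hs.1.le] at h3
    have h4 : Tendsto (fun n => B (yosidaExp (l n) (R n) s (yosida (l n) (R n) x - A x)) y) atTop
        (𝓝 0) := by
      refine squeeze_zero_norm (fun n => hpq n s _ hs.1.le) ?_
      simpa using (hR.tendsto_yosida hτ hD x hq).const_mul (Real.exp (2 * |α| * s))
    have h5 := h4.add (hτ.tendsto_apply h3 y)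
    rw [zero_add] at h5
    refine h5.congr fun n => ?_
    simp

end IsHilleYosidaSequence

end HilleYosida

/-! ### From the resolvent estimates to the semigroup -/

section Converse

variable {𝕜 X Y : Type*} [RCLike 𝕜] [NormedAddCommGroup X] [NormedSpace 𝕜 X]
  [NormedAddCommGroup Y] [NormedSpace 𝕜 Y] {B : X →ₗ[𝕜] Y →ₗ[𝕜] 𝕜}
  {l : ℕ → ℝ} {R : ℕ → BoundedOp 𝕜 X} {A : X →ₗ.[𝕜] X} {M ω α : ℝ} {T : ℝ≥0 → BoundedOp 𝕜 X}

theorem norm_pow_apply_le {S : BoundedOp 𝕜 X} {c : ℝ} (hc : 0 ≤ c)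
    (h : ∀ k : ℕ, 1 ≤ k → ‖((c : ℝ) : 𝕜) ^ k • S ^ k‖ ≤ M) (hM : 1 ≤ M) (k : ℕ) (x : X) :
    c ^ k * ‖(S ^ k) x‖ ≤ M * ‖x‖ := by
  rcases Nat.eq_zero_or_pos k with rfl | hk
  · simpa using mul_le_mul_of_nonneg_right hM (norm_nonneg x)
  · have h1 := ContinuousLinearMap.le_of_opNorm_le _ (h k hk) x
    rwa [smul_apply, norm_smul, norm_pow, RCLike.norm_ofReal, abs_of_nonneg hc] at h1

/-- The resolvent estimates for real parameters give a weakly continuous resolvent at each complex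
`z` with `re z > ω`: such `z` lie in a disc around a large real parameter where the Neumann series
converges, and this series inherits the adjoint on `Y` from its terms. -/
theorem exists_isResolventAt_hasAdjoint [CompleteSpace X] [CompleteSpace Y]
    (hB : IsNormingDualPair B) (hM : 0 ≤ M) (hl : Tendsto l atTop atTop) (hlω : ∀ n, ω < l n)
    (hR : ∀ n, IsResolventAt A (l n : 𝕜) (R n)) (hadj : ∀ n, HasAdjoint B (R n))
    (hn : ∀ n k x, (l n - ω) ^ k * ‖(R n ^ k) x‖ ≤ M * ‖x‖) {z : 𝕜} (hz : ω < RCLike.re z) :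
    ∃ S, IsResolventAt A z S ∧ HasAdjoint B S := by
  obtain ⟨n, hnz⟩ := (hl.eventually_ge_atTop
    (|ω| + |RCLike.re z| + RCLike.im z ^ 2 / (RCLike.re z - ω) + 1)).exists
  obtain ⟨S, hS, hsum, hhas⟩ := (hR n).exists_hasSum (sub_pos.2 (hlω n))
    (pow_mul_opNorm_pow_le (sub_pos.2 (hlω n)).le hM (hn n)) (norm_sub_lt_of_le hz hnz)
  exact ⟨S, hS, hB.hasAdjoint_of_hasSum
    (fun k => (((hadj n).smul _).pow k).mul (hadj n)) hsum hhas⟩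

theorem op_eq_id {S : BoundedOp 𝕜 X} (h : ∀ x, S x = x) : S = ContinuousLinearMap.id 𝕜 X :=
  ContinuousLinearMap.ext h

theorem op_eq_comp {S S₁ S₂ : BoundedOp 𝕜 X} (h : ∀ x, S x = S₁ (S₂ x)) : S = S₁.comp S₂ :=
  ContinuousLinearMap.ext h

/-- The semigroup of a Hille–Yosida sequence is integrable with generator `A`. -/
theorem IsHilleYosidaSequence.exists_isGenerator [CompleteSpace X] [CompleteSpace Y]
    {τ : TopologicalSpace X} (hR : IsHilleYosidaSequence τ A M ω α l R)
    (hB : IsNormingDualPair B) (hτ : IsConsistent B τ) (hτc : IsSeqComplete τ)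
    (hD : IsSeqDense τ (A.domain : Set X)) (hM : 1 ≤ M) :
    ∃ T : ℝ≥0 → BoundedOp 𝕜 X, IsIntegrableSemigroup B M ω T ∧ IsContinuousSemigroup τ T ∧
      IsQuasiEquicontinuous τ α T ∧ IsGenerator B ω T A := by
  obtain ⟨T, hT, hTn⟩ := hR.exists_semigroup hB hτ hτc hD
  have hM0 : 0 ≤ M := zero_le_one.trans hM
  have hnorm : ∀ t : ℝ≥0, ‖T t‖ ≤ M * Real.exp (ω * t) := fun t =>
    opNorm_le_of_forall (by positivity) (hTn t)
  have hzero := op_eq_id (limit_yosidaExp_zero hT hB hτ)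
  have hα := hR.isQuasiEquicontinuous_limit hT hB hτ
  have hcont := hR.isContinuousSemigroup_limit hT hB hτ hD
  have hadj : ∀ t, HasAdjoint B (T t) := hα.hasAdjoint hτ
  have hres : ∀ z : 𝕜, ω < RCLike.re z →
      ∃ S, IsResolventAt A z S ∧ HasAdjoint B S ∧ IsLaplaceTransformAt B T z S := fun z hz => by
    obtain ⟨S, hS, hSadj⟩ := exists_isResolventAt_hasAdjoint hB hM0 hR.tendsto hR.left_lt
      hR.isResolventAt (hR.hasAdjoint hτ) hR.norm_le hz
    refine ⟨S, hS, hSadj, hS.isLaplaceTransformAt hB hz hzero hnorm (fun x y => ?_)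
      (hR.limit_sub_eq_integral hT hB hτ hD)⟩
    exact @Continuous.comp ℝ≥0 X 𝕜 _ τ _ _ _ (hτ.continuous_apply y) (hcont x)
  refine ⟨T, ⟨⟨fun t => (hadj t).isWeaklyContinuous, hzero,
    fun t s => op_eq_comp (hR.limit_add hT hB hτ t s), hM, hnorm⟩, fun z hz => ?_⟩, hcont, hα,
    fun z hz => ?_⟩
  · obtain ⟨S, -, hSadj, hLS⟩ := hres z hz
    exact ⟨S, hSadj.isWeaklyContinuous, hLS⟩
  · obtain ⟨S, hS, -, hLS⟩ := hres z hz
    exact ⟨S, hLS, hS⟩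

/-- The estimates of Hille and Yosida provide a Hille–Yosida sequence. -/
theorem exists_isHilleYosidaSequence {τ : TopologicalSpace X} (hM : 1 ≤ M)
    (hω : ∀ r : ℝ, ω < r → (r : 𝕜) ∈ resolventSet A)
    (hn : ∀ r : ℝ, ω < r → ∀ k : ℕ, 1 ≤ k →
      ‖((r - ω : ℝ) : 𝕜) ^ k • resolvent A (r : 𝕜) ^ k‖ ≤ M)
    (heq : IsEquicontinuousSet τ {S : BoundedOp 𝕜 X | ∃ (r : ℝ) (k : ℕ), α < r ∧ 1 ≤ k ∧
      S = ((r - α : ℝ) : 𝕜) ^ k • resolvent A (r : 𝕜) ^ k}) :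
    ∃ (l : ℕ → ℝ) (R : ℕ → BoundedOp 𝕜 X), IsHilleYosidaSequence τ A M ω α l R := by
  let l : ℕ → ℝ := fun n => n + (2 * |α| + 2 * |ω| + 1)
  have hl : ∀ n, 2 * |α| + 2 * |ω| + 1 ≤ l n := fun n => le_add_of_nonneg_left n.cast_nonneg
  have hlω : ∀ n, ω < l n := fun n => by
    linarith [hl n, le_abs_self ω, abs_nonneg ω, abs_nonneg α]
  have hlα : ∀ n, α < l n := fun n => by
    linarith [hl n, le_abs_self α, abs_nonneg ω, abs_nonneg α]
  refine ⟨l, fun n => resolvent A (l n : 𝕜),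
    tendsto_atTop_add_const_right _ _ tendsto_natCast_atTop_atTop, hl, fun n => ?_,
    fun n => norm_pow_apply_le (sub_pos.2 (hlω n)).le (hn (l n) (hlω n)) hM, fun p hp => ?_⟩
  · obtain ⟨S, hS⟩ := hω (l n) (hlω n)
    rwa [hS.resolvent_eq]
  · obtain ⟨q, hq, hpq⟩ := heq p hp
    -- `q` covers only `k ≥ 1`; the summand `p` takes care of `k = 0`
    refine ⟨p + q, IsConsistent.isContinuousSeminorm_add hp hq, fun n k x => ?_⟩
    have hp0 := apply_nonneg p x
    have hq0 := apply_nonneg q x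
    rcases Nat.eq_zero_or_pos k with rfl | hk
    · simp [hq0]
    · have h1 := hpq _ ⟨l n, k, hlα n, hk, rfl⟩ x
      rw [smul_apply, map_smul_eq_mul, norm_pow, RCLike.norm_ofReal,
        abs_of_pos (sub_pos.2 (hlα n))] at h1
      exact h1.trans (le_add_of_nonneg_left hp0)

end Converse

end NormingDualPair

theorem theoremt {𝕜 X Y : Type*} [RCLike 𝕜]
    [NormedAddCommGroup X] [NormedSpace 𝕜 X] [CompleteSpace X]
    [NormedAddCommGroup Y] [NormedSpace 𝕜 Y] [CompleteSpace Y]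
    (B : X →ₗ[𝕜] Y →ₗ[𝕜] 𝕜) (hB : NormingDualPair.IsNormingDualPair B)
    (τ : TopologicalSpace X) (hτ : NormingDualPair.IsConsistent B τ)
    (hτc : NormingDualPair.IsSeqComplete τ)
    (A : X →ₗ.[𝕜] X)
    (hA : NormingDualPair.IsClosedOperator (NormingDualPair.weakTopology B) A)
    (M ω α : ℝ) (hM : 1 ≤ M) :
    (∃ T : ℝ≥0 → NormingDualPair.BoundedOp 𝕜 X,
        NormingDualPair.IsIntegrableSemigroup B M ω T ∧
        NormingDualPair.IsContinuousSemigroup τ T ∧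
        NormingDualPair.IsQuasiEquicontinuous τ α T ∧
        NormingDualPair.IsGenerator B ω T A) ↔
      (NormingDualPair.IsSeqDense τ (A.domain : Set X) ∧
        ((∀ r : ℝ, ω < r → (r : 𝕜) ∈ NormingDualPair.weakResolventSet B A) ∧
          ∀ r : ℝ, ω < r → ∀ k : ℕ, 1 ≤ k →
            ‖((r - ω : ℝ) : 𝕜) ^ k • NormingDualPair.resolvent A (r : 𝕜) ^ k‖ ≤ M) ∧
        ((∀ r : ℝ, α < r → (r : 𝕜) ∈ NormingDualPair.resolventSet A) ∧
          NormingDualPair.IsEquicontinuousSet τ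
            {S : NormingDualPair.BoundedOp 𝕜 X | ∃ (r : ℝ) (k : ℕ), α < r ∧ 1 ≤ k ∧
              S = ((r - α : ℝ) : 𝕜) ^ k • NormingDualPair.resolvent A (r : 𝕜) ^ k})) := by
  constructor
  · rintro ⟨T, hT, hc, hα, hG⟩
    exact ⟨hG.isSeqDense_domain hτ (fun x => by rw [hT.map_zero]; rfl) hc hα,
      hG.hille_yosida_estimates hB hτ hT hα⟩
  · rintro ⟨hD, ⟨hω, hn⟩, -, heq⟩
    obtain ⟨l, R, hR⟩ :=
      NormingDualPair.exists_isHilleYosidaSequence hM (fun r hr => (hω r hr).1) hn heq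
    exact hR.exists_isGenerator hB hτ hτc hD hM
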